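/- Let $D,N\ge 1$ be integers, $a>0$, $\boldsymbol K^R$ a complex $N\times N$ matrix, $|u\rangle\in\mathbb C^N$ a unit vector, and let $V:\mathbb R^D\to\mathbb C$ have an integrable Fourier transform $\tilde V$, i.e. $\tilde V\in L^1(\mathbb R^D)$ and $V(\boldsymbol k)=(2\pi)^{-D/2}\int \tilde V(\boldsymbol z)e^{-i\boldsymbol k\cdot\boldsymbol z}\,d^Dz$ for all $\boldsymbol k$. Assume $\int \frac{|V(\boldsymbol k)|^2}{1+|\boldsymbol k|^a}\,d^Dk<\infty$ (for instance $V$ square-integrable). Consider $N$ emitters with bare interaction matrix $\boldsymbol K^R$ coupled through $V_i(\boldsymbol k)=V(\boldsymbol k)u_i$ to particles with dispersion relation $\epsilon(\boldsymbol k)=|\boldsymbol k|^a$. For $\omega\in\mathbb C\setminus[0,\infty)$ put $$K_{ij}(\omega)=\int d^Dk\,\frac{V_i(\boldsymbol k)V_j^*(\boldsymbol k)}{\omega-|\boldsymbol k|^a},\qquad J(\omega)=\det[\omega\mathbb 1_N-\boldsymbol K^R-\boldsymbol K(\omega)],\qquad \boldsymbol G(\omega)=[\omega\mathbb 1_N-\boldsymbol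 K^R-\boldsymbol K(\omega)]^{-1},$$ and write $f(E\pm i0)=\lim_{\eta\to0^+}f(E\pm i\eta)$. Let $(Y_{l,q})$, $l\ge 0$, $1\le q\le N_l$, be an orthonormal system of spherical harmonics on the unit sphere of $\mathbb R^D$: for each $l$, $(Y_{l,q})_q$ is a basis of the restrictions to the sphere of the homogeneous harmonic polynomials of degree $l$ (for $D=1$: one even function for $l=0$, one odd function for $l=1$, none for $l\ge2$). For $\alpha=(l,q)$ and $E>0$ let $k=E^{1/a}$, $l'=l+\frac{D-3}{2}$, $b(D)=2\pi^{D/2}/\Gamma(D/2)$, $\rho(E)=\frac{b(D)}{a}E^{-1+D/a}$, and $$\phi_{\alpha,E}(r,\boldsymbol\theta)=\sqrt{\tfrac2\pi}\,b(D)^{-1/2}(kr)^{-\frac{D-1}{2}}\,\hat j_{l'}(kr)\,Y_{\alpha}(\boldsymbol\theta),\qquad \hat j_{\nu}(x)=\sqrt{\tfrac{\pi x}{2}}\,J_{\nu+1/2}(x)$$ (here $J_{\nu+1/2}$ is the Bessel function). Put $V_{\alpha,E}=\int d^Dz\,\tilde V(\boldsymbol z)\phi_{\alpha,E}^*(\boldsymbol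 z)$ and $|v_{\alpha,E}\rangle=V_{\alpha,E}|u\rangle$. The scattering matrix at energy $E$ is $$S_{\alpha\beta}(E)=\delta_{\alpha\beta}-2\pi i\,\rho(E)\,\langle v_{\beta,E}|\boldsymbol G(E+i0)|v_{\alpha,E}\rangle ,$$ and $\det[\boldsymbol S(E)]$ is the limit of the determinants of the finite submatrices of $\boldsymbol S(E)$ as the finite set of retained channels $\alpha$ increases to the set of all channels; in particular, for any enumeration of the channels it is the limit as $n\to\infty$ of the determinants of the $n\times n$ truncations (for $D=1$ it is the determinant of a $2\times2$ matrix). Then for every $E>0$ the limits $\boldsymbol K(E+i0)$ and $J(E\pm i0)$ exist. If moreover $E$ is not the energy of a bound state in the continuum, i.e. $E\mathbb 1_N-\boldsymbol K^R-\boldsymbol K(E+i0)$ does not have the eigenvalue $0$, then $\boldsymbol G(E+i0)$ exists, $J(E+i0)\ne0$, $\det[\boldsymbol S(E)]$ exists, and $$\det[\boldsymbol S(E)]=\frac{J(E-i0)}{J(E+i0)} .$$ -/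

import Mathlib

open Filter Topology MeasureTheory

noncomputable section

namespace EmitterScattering

/-- Position or momentum space `ℝ^D` with its Euclidean norm. -/
abbrev Space (D : ℕ) : Type := EuclideanSpace ℝ (Fin D)

/-! ### Boundary values on the real axis -/

/-- `f(E + i0) = lim_{η → 0⁺} f(E + iη)`. -/
def above {X : Type*} [TopologicalSpace X] [Nonempty X] (f : ℂ → X) (E : ℝ) : X :=
  limUnder (𝓝[>] (0 : ℝ)) (fun η : ℝ => f ((E : ℂ) + (η : ℂ) * Complex.I))

/-- `f(E - i0) = lim_{η → 0⁺} f(E - iη)`. -/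
def below {X : Type*} [TopologicalSpace X] [Nonempty X] (f : ℂ → X) (E : ℝ) : X :=
  limUnder (𝓝[>] (0 : ℝ)) (fun η : ℝ => f ((E : ℂ) - (η : ℂ) * Complex.I))

/-- The limit `f(E + i0)` exists. -/
def HasAbove {X : Type*} [TopologicalSpace X] [Nonempty X] (f : ℂ → X) (E : ℝ) : Prop :=
  Tendsto (fun η : ℝ => f ((E : ℂ) + (η : ℂ) * Complex.I)) (𝓝[>] (0 : ℝ)) (𝓝 (above f E))

/-- The limit `f(E - i0)` exists. -/
def HasBelow {X : Type*} [TopologicalSpace X] [Nonempty X] (f : ℂ → X) (E : ℝ) : Prop :=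
  Tendsto (fun η : ℝ => f ((E : ℂ) - (η : ℂ) * Complex.I)) (𝓝[>] (0 : ℝ)) (𝓝 (below f E))

/-! ### The emitter model with dispersion relation `ε(k) = |k|^a` -/

/-- `V` and `Vt` form a Fourier pair in the unitary convention
`Vt(z) = (2π)^{-D/2} ∫ exp(i k·z) V(k) dk`, with `Vt` integrable; the relation is expressed by the
inverse transform `V(k) = (2π)^{-D/2} ∫ exp(-i k·z) Vt(z) dz`, which converges for every `k`. -/
def IsFourierPair {D : ℕ} (V Vt : Space D → ℂ) : Prop :=
  Integrable Vt ∧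
    ∀ k : Space D, V k = (((2 * Real.pi) ^ (-(D : ℝ) / 2) : ℝ) : ℂ) *
      ∫ z : Space D, Complex.exp (-Complex.I * ((inner ℝ k z : ℝ) : ℂ)) * Vt z

/-- The coupling vector `|v_k⟩ = V(k)|u⟩ = (V_1(k), …, V_N(k))`. -/
def couplingVec {D N : ℕ} (V : Space D → ℂ) (u : EuclideanSpace ℂ (Fin N)) (k : Space D) :
    Fin N → ℂ :=
  fun i => V k * u i

/-- `K_{ij}(ω) = ∫ V_i(k) V_j(k)^* / (ω - |k|^a) d^D k`. -/
def K {D N : ℕ} (a : ℝ) (V : Space D → ℂ) (u : EuclideanSpace ℂ (Fin N)) (ω : ℂ) :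
    Matrix (Fin N) (Fin N) ℂ :=
  Matrix.of fun i j => ∫ k : Space D,
    couplingVec V u k i * star (couplingVec V u k j) / (ω - ((‖k‖ ^ a : ℝ) : ℂ))

/-- `ω 1 - K^R - K(ω)`. -/
def H {D N : ℕ} (a : ℝ) (KR : Matrix (Fin N) (Fin N) ℂ) (V : Space D → ℂ)
    (u : EuclideanSpace ℂ (Fin N)) (ω : ℂ) : Matrix (Fin N) (Fin N) ℂ :=
  ω • (1 : Matrix (Fin N) (Fin N) ℂ) - KR - K a V u ω

/-- `J(ω) = det[ω 1 - K^R - K(ω)]`. -/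
def J {D N : ℕ} (a : ℝ) (KR : Matrix (Fin N) (Fin N) ℂ) (V : Space D → ℂ)
    (u : EuclideanSpace ℂ (Fin N)) (ω : ℂ) : ℂ :=
  (H a KR V u ω).det

/-- The Green's function of the emitters, `G(ω) = [ω 1 - K^R - K(ω)]⁻¹`. -/
def G {D N : ℕ} (a : ℝ) (KR : Matrix (Fin N) (Fin N) ℂ) (V : Space D → ℂ)
    (u : EuclideanSpace ℂ (Fin N)) (ω : ℂ) : Matrix (Fin N) (Fin N) ℂ :=
  (H a KR V u ω)⁻¹

/-- `E` is the energy of a bound state in the continuum: `E 1 - K^R - K(E + i0)` has the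
eigenvalue zero. -/
def IsBoundStateInContinuum {D N : ℕ} (a : ℝ) (KR : Matrix (Fin N) (Fin N) ℂ)
    (V : Space D → ℂ) (u : EuclideanSpace ℂ (Fin N)) (E : ℝ) : Prop :=
  ∃ e : Fin N → ℂ, e ≠ 0 ∧
    ((E : ℂ) • (1 : Matrix (Fin N) (Fin N) ℂ) - KR - above (K a V u) E).mulVec e = 0

/-! ### Spherical harmonics and angular momentum eigenstates -/

/-- Homogeneous harmonic polynomials of degree `l` in `D` variables; their restrictions to the unit
sphere are the spherical harmonics of angular momentum `l`. For `D = 1` this gives the even wave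
(`l = 0`), the odd wave (`l = 1`), and nothing for `l ≥ 2`. -/
def harmonicPoly (D l : ℕ) : Submodule ℂ (MvPolynomial (Fin D) ℂ) where
  carrier := {p | p.IsHomogeneous l ∧
    ∑ i : Fin D, MvPolynomial.pderiv i (MvPolynomial.pderiv i p) = 0}
  add_mem' := by
    rintro p q ⟨hp, hp'⟩ ⟨hq, hq'⟩
    exact ⟨hp.add hq, by simp [Finset.sum_add_distrib, hp', hq']⟩
  zero_mem' := ⟨MvPolynomial.isHomogeneous_zero _ _ _, by simp⟩
  smul_mem' := by
    rintro c p ⟨hp, hp'⟩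
    exact ⟨(MvPolynomial.homogeneousSubmodule (Fin D) ℂ l).smul_mem c hp,
      by simp [← Finset.smul_sum, hp']⟩

/-- The number `N_l` of linearly independent spherical harmonics of angular momentum `l`. -/
def multiplicity (D l : ℕ) : ℕ := Module.finrank ℂ (harmonicPoly D l)

/-- The angular momentum channels `α = (l, q_l)`. -/
abbrev Channel (D : ℕ) : Type := (l : ℕ) × Fin (multiplicity D l)

/-- The value of a complex polynomial at a point of `ℝ^D`. -/
def evalAt {D : ℕ} (p : MvPolynomial (Fin D) ℂ) (x : Space D) : ℂ :=
  MvPolynomial.eval (fun i => ((x i : ℝ) : ℂ)) p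

/-- A choice of spherical harmonics `Y_{l,q}`: for each `l` a basis of the spherical harmonics of
angular momentum `l`, orthonormal for the surface measure of the unit sphere. -/
structure SphericalHarmonics (D : ℕ) where
  basis : (l : ℕ) → Module.Basis (Fin (multiplicity D l)) ℂ (harmonicPoly D l)
  orthonormal : ∀ α β : Channel D,
    ∫ θ : Metric.sphere (0 : Space D) 1,
      star (evalAt (basis α.1 α.2 : MvPolynomial (Fin D) ℂ) θ) *
        evalAt (basis β.1 β.2 : MvPolynomial (Fin D) ℂ) θ
      ∂((volume : Measure (Space D)).toSphere) = if α = β then 1 else 0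

/-- The value `Y_α(θ)`. -/
def SphericalHarmonics.Y {D : ℕ} (B : SphericalHarmonics D) (α : Channel D) (θ : Space D) : ℂ :=
  evalAt (B.basis α.1 α.2 : MvPolynomial (Fin D) ℂ) θ

/-- The area `b(D) = 2 π^{D/2} / Γ(D/2)` of the unit sphere of `ℝ^D`. -/
def sphereArea (D : ℕ) : ℝ := 2 * Real.pi ^ ((D : ℝ) / 2) / Real.Gamma ((D : ℝ) / 2)

/-- The density of states `ρ(E) = (b(D) / a) E^{-1 + D/a}`. -/
def density (D : ℕ) (a E : ℝ) : ℝ := sphereArea D / a * E ^ (-1 + (D : ℝ) / a)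

/-- The Riccati-Bessel function
`ĵ_ν(x) = √(πx/2) J_{ν+1/2}(x) = x^{ν+1} √(π/2) ∑ₙ (-x²/2)ⁿ / (n! 2^{n+ν+1/2} Γ(ν+n+3/2))`. -/
def riccatiBessel (ν x : ℝ) : ℝ :=
  x ^ (ν + 1) * Real.sqrt (Real.pi / 2) *
    ∑' n : ℕ, (-x ^ 2 / 2) ^ n /
      ((n.factorial : ℝ) * 2 ^ ((n : ℝ) + ν + 1 / 2) * Real.Gamma (ν + (n : ℝ) + 3 / 2))

/-- The angular momentum eigenstate
`φ_{α,E}(r,θ) = √(2/π) b(D)^{-1/2} (kr)^{-(D-1)/2} ĵ_{l'}(kr) Y_α(θ)` with `k = E^{1/a}` and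
`l' = l + (D-3)/2`, as a function of `z = rθ` (its value at the single point `z = 0` is
immaterial). -/
def eigenstate {D : ℕ} (B : SphericalHarmonics D) (a E : ℝ) (α : Channel D) (z : Space D) : ℂ :=
  ((Real.sqrt (2 / Real.pi) * sphereArea D ^ (-(1 / 2) : ℝ) *
      (E ^ (1 / a) * ‖z‖) ^ (-((D : ℝ) - 1) / 2) *
      riccatiBessel ((α.1 : ℝ) + ((D : ℝ) - 3) / 2) (E ^ (1 / a) * ‖z‖) : ℝ) : ℂ) *
    B.Y α (‖z‖⁻¹ • z)

/-- `V_{α,E} = ∫ Vt(z) φ_{α,E}(z)^* d^D z`. -/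
def channelCoupling {D : ℕ} (B : SphericalHarmonics D) (a : ℝ) (Vt : Space D → ℂ) (E : ℝ)
    (α : Channel D) : ℂ :=
  ∫ z : Space D, Vt z * star (eigenstate B a E α z)

/-- `|v_{α,E}⟩ = V_{α,E}|u⟩`. -/
def channelVec {D N : ℕ} (B : SphericalHarmonics D) (a : ℝ) (Vt : Space D → ℂ)
    (u : EuclideanSpace ℂ (Fin N)) (E : ℝ) (α : Channel D) : Fin N → ℂ :=
  fun i => channelCoupling B a Vt E α * u i

/-! ### The scattering matrix and its determinant -/

/-- The on-shell matrix element `T(E + i0, α, E, β, E) = ⟨v_{β,E}| G(E + i0) |v_{α,E}⟩`. -/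
def T {D N : ℕ} (B : SphericalHarmonics D) (a : ℝ) (KR : Matrix (Fin N) (Fin N) ℂ)
    (V Vt : Space D → ℂ) (u : EuclideanSpace ℂ (Fin N)) (E : ℝ) (α β : Channel D) : ℂ :=
  star (channelVec B a Vt u E β) ⬝ᵥ
    (above (G a KR V u) E).mulVec (channelVec B a Vt u E α)

/-- The scattering matrix `S_{αβ}(E) = δ_{αβ} - 2πi ρ(E) T(E + i0, α, E, β, E)`. -/
def S {D N : ℕ} (B : SphericalHarmonics D) (a : ℝ) (KR : Matrix (Fin N) (Fin N) ℂ)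
    (V Vt : Space D → ℂ) (u : EuclideanSpace ℂ (Fin N)) (E : ℝ) :
    Matrix (Channel D) (Channel D) ℂ :=
  Matrix.of fun α β => (if α = β then 1 else 0) -
    2 * (Real.pi : ℂ) * Complex.I * ((density D a E : ℝ) : ℂ) * T B a KR V Vt u E α β

/-- `det M = d` for a possibly infinite matrix: the determinants of the finite truncations of `M`
converge to `d` as the finite set of retained indices exhausts the index set. This implies
convergence of the `n × n` truncations for every enumeration of the indices (see below), and for a
finite index set it says that `d` is the usual determinant. -/
def HasDet {ι : Type*} [DecidableEq ι] (M : Matrix ι ι ℂ) (d : ℂ) : Prop :=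
  Tendsto (fun s : Finset ι => (M.submatrix (fun i : s => (i : ι)) (fun i : s => (i : ι))).det)
    atTop (𝓝 d)

theorem HasDet.tendsto_truncation {ι : Type*} [DecidableEq ι] {M : Matrix ι ι ℂ} {d : ℂ}
    (h : HasDet M d) (e : ℕ ≃ ι) :
    Tendsto (fun n : ℕ => (M.submatrix (fun i : Fin n => e i) (fun i : Fin n => e i)).det)
      atTop (𝓝 d) := by
  have h1 : Tendsto (fun n : ℕ => (Finset.range n).map e.toEmbedding) atTop atTop := by
    refine tendsto_atTop_finset_of_monotone ?_ ?_
    · intro m n hmn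
      exact Finset.map_subset_map.2 (Finset.range_mono hmn)
    · intro x
      exact ⟨e.symm x + 1, by simp⟩
  refine (h.comp h1).congr fun n => ?_
  let f : Fin n ≃ ((Finset.range n).map e.toEmbedding : Finset ι) :=
    { toFun := fun i => ⟨e i, by simp⟩
      invFun := fun x => ⟨e.symm x, by simpa using x.2⟩
      left_inv := fun i => by simp
      right_inv := fun x => by simp }
  simp only [Function.comp]
  rw [← Matrix.det_submatrix_equiv_self f]
  rfl

end EmitterScattering

end

/-!
The matrix `K(ω) = k(ω) |u⟩⟨u|` is a scalar self-energy `k(ω) = ∫ |V|² / (ω - |k|^a)` times a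
rank-one matrix. In the radial variable `r = |k|` the shell mass of `|V|²` is a superposition of
plane waves, because `V` is one; multiplied by a bump it lies in the Wiener algebra of the line, and
for such functions the boundary values of the Cauchy integral exist. Linearizing `|k|^a` on the
shell `|k|^a = E` transfers this to `k(E + i0)`; its imaginary part is `-π` times the spectral
weight of `|V|²` on the shell, and `k(E - i0)` is its complex conjugate.

By the matrix determinant lemma the jump of `k` across the real axis turns `J(E - i0) / J(E + i0)`
into `1 - 2πi σ ⟨u|G(E + i0)|u⟩` with `σ` that spectral weight. On the other side `S` is a rank-one
perturbation of the identity, so its determinant is `1 - 2πi ρ(E) (∑ |V_α|²) ⟨u|G(E + i0)|u⟩`.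
The two agree by Parseval's identity on the sphere: up to a factor independent of `V`, the number
`V_α` is the coefficient of `V` on the shell along `Y_α`, by the expansion of a plane wave in Bessel
functions. That expansion follows from the Gaussian moments of `(w · x)^m h(x)` for `h` harmonic,
which integration by parts computes.
-/

noncomputable section

namespace EmitterScattering

section HarmonicPolynomials

open MvPolynomial

variable {D : ℕ}

/-- The squared radius `|x|² = ∑ i, x_i²` as a polynomial. -/
def sqRadius (D : ℕ) : MvPolynomial (Fin D) ℂ := ∑ i, X i ^ 2

/-- The Laplacian as a linear operator on polynomials. -/
def polyLaplacian (D : ℕ) : MvPolynomial (Fin D) ℂ →ₗ[ℂ] MvPolynomial (Fin D) ℂ :=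
  ∑ i, (pderiv i).toLinearMap ∘ₗ (pderiv i).toLinearMap

theorem polyLaplacian_apply (p : MvPolynomial (Fin D) ℂ) :
    polyLaplacian D p = ∑ i, pderiv i (pderiv i p) := by
  simp [polyLaplacian]

theorem mem_harmonicPoly_iff {l : ℕ} {p : MvPolynomial (Fin D) ℂ} :
    p ∈ harmonicPoly D l ↔ p.IsHomogeneous l ∧ polyLaplacian D p = 0 := by
  rw [polyLaplacian_apply]; rfl

theorem exists_eq_C_of_isHomogeneous_zero {p : MvPolynomial (Fin D) ℂ} (hp : p.IsHomogeneous 0) :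
    ∃ c, p = C c :=
  ⟨_, totalDegree_eq_zero_iff_eq_C.1 (Nat.le_zero.1 hp.totalDegree_le)⟩

theorem isHomogeneous_polyLaplacian {n : ℕ} {p : MvPolynomial (Fin D) ℂ}
    (hp : p.IsHomogeneous (n + 2)) : (polyLaplacian D p).IsHomogeneous n := by
  rw [polyLaplacian_apply]
  exact IsHomogeneous.sum _ _ _ fun i _ => (hp.pderiv (i := i)).pderiv (i := i)

theorem polyLaplacian_eq_zero_of_lt_two {n : ℕ} (hn : n < 2) {p : MvPolynomial (Fin D) ℂ}
    (hp : p.IsHomogeneous n) : polyLaplacian D p = 0 := by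
  rw [polyLaplacian_apply]
  refine Finset.sum_eq_zero fun i _ => ?_
  have hderiv : (pderiv i p).IsHomogeneous 0 := by
    simpa only [show n - 1 = 0 by omega] using hp.pderiv (i := i)
  obtain ⟨c, hc⟩ := exists_eq_C_of_isHomogeneous_zero hderiv
  rw [hc, pderiv_C]

theorem isHomogeneous_sqRadius : (sqRadius D).IsHomogeneous 2 :=
  IsHomogeneous.sum _ _ _ fun i _ => by simpa using (isHomogeneous_X ℂ i).pow 2

theorem pderiv_sqRadius (i : Fin D) : pderiv i (sqRadius D) = C 2 * X i := by
  classical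
  simp [sqRadius, pderiv_X, Pi.single_apply, mul_comm, map_ofNat]

theorem polyLaplacian_sqRadius_mul {n : ℕ} {p : MvPolynomial (Fin D) ℂ} (hp : p.IsHomogeneous n) :
    polyLaplacian D (sqRadius D * p) =
      (2 * D + 4 * n : ℕ) • p + sqRadius D * polyLaplacian D p := by
  have second_pderiv (i : Fin D) : pderiv i (pderiv i (sqRadius D * p)) =
      2 * p + 4 * (X i * pderiv i p) + sqRadius D * pderiv i (pderiv i p) := by
    simp only [Derivation.leibniz, pderiv_sqRadius, smul_eq_mul, map_add, pderiv_X_self, pderiv_C]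
    simp only [map_ofNat]
    ring
  simp only [polyLaplacian_apply, second_pderiv, Finset.sum_add_distrib, ← Finset.mul_sum,
    hp.sum_X_mul_pderiv, Finset.sum_const, Finset.card_univ, Fintype.card_fin, nsmul_eq_mul]
  push_cast
  ring

theorem exists_polyLaplacian_sqRadius_pow_mul {l : ℕ} (hD : 1 ≤ D) {h : MvPolynomial (Fin D) ℂ}
    (hh : h ∈ harmonicPoly D l) (j : ℕ) :
    ∃ c : ℕ, 0 < c ∧ polyLaplacian D (sqRadius D ^ (j + 1) * h) = c • (sqRadius D ^ j * h) := by
  obtain ⟨hom, harm⟩ := mem_harmonicPoly_iff.1 hh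
  induction j with
  | zero => exact ⟨2 * D + 4 * l, by omega, by simp [polyLaplacian_sqRadius_mul hom, harm]⟩
  | succ j ih =>
    obtain ⟨c, hc, hlap⟩ := ih
    refine ⟨2 * D + 4 * (2 * (j + 1) + l) + c, by omega, ?_⟩
    rw [pow_succ' _ (j + 1), mul_assoc,
      polyLaplacian_sqRadius_mul ((isHomogeneous_sqRadius.pow (j + 1)).mul hom), hlap,
      mul_smul_comm, pow_succ' _ j, mul_assoc, ← add_smul]

/-- The polynomials of degree `m` in the span of the products `|x|^{2j} h` with `h` harmonic; by
Fischer's decomposition `mem_radialHarmonicSpan` these are all homogeneous ones. -/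
def radialHarmonicSpan (D m : ℕ) : Submodule ℂ (MvPolynomial (Fin D) ℂ) :=
  Submodule.span ℂ {p | ∃ j l, 2 * j + l = m ∧ ∃ h ∈ harmonicPoly D l, p = sqRadius D ^ j * h}

theorem sqRadius_pow_mul_mem_radialHarmonicSpan (j : ℕ) {l : ℕ} {h : MvPolynomial (Fin D) ℂ}
    (hh : h ∈ harmonicPoly D l) : sqRadius D ^ j * h ∈ radialHarmonicSpan D (2 * j + l) :=
  Submodule.subset_span ⟨j, l, rfl, h, hh, rfl⟩

theorem mem_radialHarmonicSpan_of_mem_harmonicPoly {l : ℕ} {h : MvPolynomial (Fin D) ℂ}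
    (hh : h ∈ harmonicPoly D l) : h ∈ radialHarmonicSpan D l := by
  simpa using sqRadius_pow_mul_mem_radialHarmonicSpan 0 hh

theorem isHomogeneous_of_mem_radialHarmonicSpan {m : ℕ} {p : MvPolynomial (Fin D) ℂ}
    (hp : p ∈ radialHarmonicSpan D m) : p.IsHomogeneous m := by
  rw [← mem_homogeneousSubmodule]
  refine Submodule.span_le.2 ?_ hp
  rintro _ ⟨j, l, rfl, h, hh, rfl⟩
  exact (isHomogeneous_sqRadius.pow j).mul (mem_harmonicPoly_iff.1 hh).1

theorem radialHarmonicSpan_le_map_polyLaplacian (hD : 1 ≤ D) (m : ℕ) :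
    radialHarmonicSpan D m ≤ (radialHarmonicSpan D (m + 2)).map (polyLaplacian D) := by
  refine Submodule.span_le.2 ?_
  rintro _ ⟨j, l, rfl, h, hh, rfl⟩
  obtain ⟨c, hc, hlap⟩ := exists_polyLaplacian_sqRadius_pow_mul hD hh j
  refine ⟨(c : ℂ)⁻¹ • (sqRadius D ^ (j + 1) * h), Submodule.smul_mem _ _ ?_, ?_⟩
  · convert sqRadius_pow_mul_mem_radialHarmonicSpan (j + 1) hh using 2
    ring
  · rw [map_smul, hlap, ← Nat.cast_smul_eq_nsmul ℂ, smul_smul,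
      inv_mul_cancel₀ (by exact_mod_cast hc.ne'), one_smul]

theorem mem_radialHarmonicSpan (hD : 1 ≤ D) (m : ℕ) {p : MvPolynomial (Fin D) ℂ}
    (hp : p.IsHomogeneous m) : p ∈ radialHarmonicSpan D m := by
  induction m using Nat.twoStepInduction generalizing p with
  | zero | one =>
    exact mem_radialHarmonicSpan_of_mem_harmonicPoly
      (mem_harmonicPoly_iff.2 ⟨hp, polyLaplacian_eq_zero_of_lt_two (by norm_num) hp⟩)
  | more n ih _ =>
    obtain ⟨q, hq, hlap⟩ :=
      radialHarmonicSpan_le_map_polyLaplacian hD n (ih (isHomogeneous_polyLaplacian hp))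
    have harmonic_sub : p - q ∈ harmonicPoly D (n + 2) :=
      mem_harmonicPoly_iff.2 ⟨hp.sub (isHomogeneous_of_mem_radialHarmonicSpan hq),
        by rw [map_sub, hlap, sub_self]⟩
    simpa using add_mem (mem_radialHarmonicSpan_of_mem_harmonicPoly harmonic_sub) hq

theorem evalAt_add (p q : MvPolynomial (Fin D) ℂ) (x : Space D) :
    evalAt (p + q) x = evalAt p x + evalAt q x := map_add _ _ _

theorem evalAt_mul (p q : MvPolynomial (Fin D) ℂ) (x : Space D) :
    evalAt (p * q) x = evalAt p x * evalAt q x := map_mul _ _ _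

theorem evalAt_pow (p : MvPolynomial (Fin D) ℂ) (n : ℕ) (x : Space D) :
    evalAt (p ^ n) x = evalAt p x ^ n := map_pow _ _ _

theorem evalAt_smul (c : ℂ) (p : MvPolynomial (Fin D) ℂ) (x : Space D) :
    evalAt (c • p) x = c * evalAt p x := by simp [evalAt]

theorem evalAt_sum {ι : Type*} (s : Finset ι) (p : ι → MvPolynomial (Fin D) ℂ) (x : Space D) :
    evalAt (∑ i ∈ s, p i) x = ∑ i ∈ s, evalAt (p i) x := map_sum _ _ _

@[simp] theorem evalAt_X (i : Fin D) (x : Space D) : evalAt (X i) x = (x i : ℝ) := by simp [evalAt]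

@[simp] theorem evalAt_C (c : ℂ) (x : Space D) : evalAt (C c) x = c := by simp [evalAt]

theorem evalAt_sqRadius (x : Space D) : evalAt (sqRadius D) x = ((‖x‖ ^ 2 : ℝ) : ℂ) := by
  rw [EuclideanSpace.norm_sq_eq]
  simp [sqRadius, evalAt_sum, evalAt_pow]

theorem continuous_evalAt (p : MvPolynomial (Fin D) ℂ) : Continuous (evalAt p) := by
  unfold evalAt
  exact p.continuous_eval.comp (by fun_prop)

theorem evalAt_real_smul {m : ℕ} {p : MvPolynomial (Fin D) ℂ} (hp : p.IsHomogeneous m)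
    (r : ℝ) (x : Space D) : evalAt p (r • x) = (r : ℂ) ^ m * evalAt p x := by
  simp only [evalAt, eval_eq', Finset.mul_sum]
  refine Finset.sum_congr rfl fun d hd => ?_
  have degree_eq : ∑ i, d i = m := by
    rw [← Finsupp.degree_eq_sum, Finsupp.degree_eq_weight_one]
    exact hp (mem_support_iff.1 hd)
  simp only [PiLp.smul_apply, smul_eq_mul, Complex.ofReal_mul, mul_pow, Finset.prod_mul_distrib,
    Finset.prod_pow_eq_pow_sum, degree_eq]
  ring

end HarmonicPolynomials

section GaussianMoments

open MvPolynomial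

variable {D : ℕ}

/-- The Gaussian weight `exp(-|x|²/2)`. -/
def gaussWeight (x : Space D) : ℂ := ((Real.exp (-(1 / 2) * ‖x‖ ^ 2) : ℝ) : ℂ)

theorem integral_gaussWeight :
    ∫ x : Space D, gaussWeight x = (((2 * Real.pi) ^ ((D : ℝ) / 2) : ℝ) : ℂ) := by
  unfold gaussWeight
  rw [integral_complex_ofReal, GaussianFourier.integral_rexp_neg_mul_sq_norm (by norm_num)]
  simp [mul_comm]

theorem exists_norm_evalAt_le_exp (p : MvPolynomial (Fin D) ℂ) :
    ∃ C b : ℝ, ∀ x : Space D, ‖evalAt p x‖ ≤ C * Real.exp (b * ‖x‖) := by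
  induction p using MvPolynomial.induction_on with
  | C c => exact ⟨‖c‖, 0, fun x => by simp⟩
  | add p q hp hq =>
    obtain ⟨C₁, b₁, hp⟩ := hp
    obtain ⟨C₂, b₂, hq⟩ := hq
    refine ⟨|C₁| + |C₂|, max b₁ b₂, fun x => ?_⟩
    rw [evalAt_add, add_mul]
    refine (norm_add_le _ _).trans (add_le_add ((hp x).trans ?_) ((hq x).trans ?_)) <;>
    gcongr
    exacts [le_abs_self _, le_max_left _ _, le_abs_self _, le_max_right _ _]
  | mul_X p i hp =>
    obtain ⟨C, b, hp⟩ := hp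
    refine ⟨C, b + 1, fun x => ?_⟩
    have coordinate_le : ‖(x i : ℂ)‖ ≤ Real.exp ‖x‖ := by
      rw [Complex.norm_real]
      linarith [PiLp.norm_apply_le x i, Real.add_one_le_exp ‖x‖]
    rw [evalAt_mul, evalAt_X, norm_mul, add_mul, one_mul, Real.exp_add, ← mul_assoc]
    exact mul_le_mul (hp x) coordinate_le (norm_nonneg _) ((norm_nonneg _).trans (hp x))

theorem integrable_evalAt_mul_gaussWeight (p : MvPolynomial (Fin D) ℂ) :
    Integrable fun x : Space D => evalAt p x * gaussWeight x := by
  obtain ⟨C, b, hC⟩ := exists_norm_evalAt_le_exp p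
  have gaussian_integrable : Integrable fun x : Space D =>
      C * Real.exp (b ^ 2) * Real.exp (-(1 / 4) * ‖x‖ ^ 2) := by
    refine (Integrable.congr (GaussianFourier.integrable_cexp_neg_mul_sq_norm_add (V := Space D)
      (b := 1 / 4) (by norm_num) 0 0).re (ae_of_all _ fun x => ?_)).const_mul _
    simp [Complex.exp_re, ← Complex.ofReal_pow]
  have continuous_gaussWeight : Continuous (gaussWeight (D := D)) := by
    unfold gaussWeight; fun_prop
  refine gaussian_integrable.mono'
    ((continuous_evalAt p).mul continuous_gaussWeight).aestronglyMeasurable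
    (ae_of_all _ fun x => ?_)
  rw [norm_mul, gaussWeight, Complex.norm_real, Real.norm_eq_abs, Real.abs_exp]
  have hC_nonneg : 0 ≤ C :=
    nonneg_of_mul_nonneg_left ((norm_nonneg _).trans (hC x)) (Real.exp_pos _)
  calc ‖evalAt p x‖ * Real.exp (-(1 / 2) * ‖x‖ ^ 2)
      ≤ (C * Real.exp (b * ‖x‖)) * Real.exp (-(1 / 2) * ‖x‖ ^ 2) := by gcongr; exact hC x
    _ = C * Real.exp (b * ‖x‖ + -(1 / 2) * ‖x‖ ^ 2) := by rw [mul_assoc, ← Real.exp_add]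
    _ ≤ C * Real.exp (b ^ 2 + -(1 / 4) * ‖x‖ ^ 2) := by
        gcongr ?_ * Real.exp ?_
        nlinarith [sq_nonneg (b - ‖x‖ / 2)]
    _ = C * Real.exp (b ^ 2) * Real.exp (-(1 / 4) * ‖x‖ ^ 2) := by rw [Real.exp_add, mul_assoc]

theorem hasLineDerivAt_evalAt (p : MvPolynomial (Fin D) ℂ) (x : Space D) (i : Fin D) :
    HasLineDerivAt ℝ (evalAt p) (evalAt (pderiv i p) x) x (EuclideanSpace.single i 1) := by
  classical
  unfold HasLineDerivAt
  induction p using MvPolynomial.induction_on with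
  | C c => simpa [evalAt] using hasDerivAt_const (0 : ℝ) c
  | add p q hp hq =>
    simp only [evalAt_add, map_add]
    exact hp.add hq
  | mul_X p j hp =>
    have coordinate_deriv : HasDerivAt
        (fun t : ℝ => evalAt (X j) (x + t • EuclideanSpace.single i (1 : ℝ)))
        (evalAt (pderiv i (X j)) x) 0 := by
      rcases eq_or_ne j i with rfl | hij
      · simpa [evalAt] using ((hasDerivAt_id (0 : ℝ)).const_add (x j)).ofReal_comp
      · simpa [hij, hij.symm, evalAt, pderiv_X] using hasDerivAt_const (0 : ℝ) ((x j : ℝ) : ℂ)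
    simp only [Derivation.leibniz, evalAt_add, evalAt_mul, smul_eq_mul]
    have product_deriv := hp.mul coordinate_deriv
    rw [zero_smul, add_zero] at product_deriv
    rwa [add_comm, mul_comm (evalAt (X j) x)]

theorem hasLineDerivAt_gaussWeight (x : Space D) (i : Fin D) :
    HasLineDerivAt ℝ gaussWeight (-(x i : ℂ) * gaussWeight x) x (EuclideanSpace.single i 1) := by
  have real_deriv : HasFDerivAt (fun y : Space D => Real.exp (-(1 / 2) * ‖y‖ ^ 2)) _ x :=
    ((hasStrictFDerivAt_norm_sq x).hasFDerivAt.const_mul (-(1 / 2))).exp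
  have line_deriv := (Complex.ofRealCLM.hasFDerivAt.comp x real_deriv).hasLineDerivAt
    (EuclideanSpace.single i 1)
  convert! line_deriv using 1
  simp [gaussWeight, EuclideanSpace.inner_single_right, mul_comm]

/-- The Gaussian moment functional `p ↦ ∫ p(x) exp(-|x|²/2) dx` on polynomials. -/
def gaussMoment (D : ℕ) : MvPolynomial (Fin D) ℂ →ₗ[ℂ] ℂ where
  toFun p := ∫ x : Space D, evalAt p x * gaussWeight x
  map_add' p q := by
    simp only [evalAt_add, add_mul]
    exact integral_add (integrable_evalAt_mul_gaussWeight p) (integrable_evalAt_mul_gaussWeight q)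
  map_smul' c p := by
    simp only [evalAt_smul, mul_assoc, RingHom.id_apply, smul_eq_mul, integral_const_mul]

theorem gaussMoment_apply (p : MvPolynomial (Fin D) ℂ) :
    gaussMoment D p = ∫ x : Space D, evalAt p x * gaussWeight x := rfl

theorem gaussMoment_X_mul (i : Fin D) (p : MvPolynomial (Fin D) ℂ) :
    gaussMoment D (X i * p) = gaussMoment D (pderiv i p) := by
  have move_X (x : Space D) : evalAt p x * (-(x i : ℂ) * gaussWeight x) =
      -(evalAt (X i * p) x * gaussWeight x) := by
    rw [evalAt_mul, evalAt_X]; ring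
  have by_parts := integral_bilinear_hasLineDerivAt_right_eq_neg_left_of_integrable
    (μ := (volume : Measure (Space D))) (B := ContinuousLinearMap.mul ℝ ℂ)
    (f := evalAt p) (g := gaussWeight)
    (integrable_evalAt_mul_gaussWeight (pderiv i p))
    ((integrable_evalAt_mul_gaussWeight (X i * p)).neg.congr
      (ae_of_all _ fun x => (move_X x).symm))
    (integrable_evalAt_mul_gaussWeight p)
    (fun x _ => hasLineDerivAt_evalAt p x i) (fun x _ => hasLineDerivAt_gaussWeight x i)
  simp only [ContinuousLinearMap.mul_apply', move_X, integral_neg, neg_inj] at by_parts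
  exact by_parts

/-- The linear form `x ↦ w · x`. -/
def linForm (w : Space D) : MvPolynomial (Fin D) ℂ := ∑ i, C (w i : ℂ) * X i

/-- The directional derivative of polynomials along `w`. -/
def dirDeriv (w : Space D) : Derivation ℂ (MvPolynomial (Fin D) ℂ) (MvPolynomial (Fin D) ℂ) :=
  mkDerivation ℂ fun i => C (w i : ℂ)

theorem dirDeriv_apply (w : Space D) (p : MvPolynomial (Fin D) ℂ) :
    dirDeriv w p = ∑ i, C (w i : ℂ) * pderiv i p := by
  induction p using MvPolynomial.induction_on with
  | C c => simp [dirDeriv, mkDerivation]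
  | add p q hp hq => simp only [map_add, hp, hq, mul_add, Finset.sum_add_distrib]
  | mul_X p j hp =>
    classical
    simp [hp, show dirDeriv w (X j) = C (w j : ℂ) from mkDerivation_X _ _ _, pderiv_X,
      Pi.single_apply, mul_add, Finset.sum_add_distrib, Finset.mul_sum, mul_left_comm, mul_comm]

theorem evalAt_linForm (w x : Space D) : evalAt (linForm w) x = ((inner ℝ x w : ℝ) : ℂ) := by
  simp [linForm, evalAt_sum, evalAt_mul, PiLp.inner_apply]

theorem pderiv_linForm (w : Space D) (i : Fin D) : pderiv i (linForm w) = C (w i : ℂ) := by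
  classical
  simp [linForm, pderiv_X, Pi.single_apply]

theorem dirDeriv_linForm (w : Space D) : dirDeriv w (linForm w) = C ((‖w‖ ^ 2 : ℝ) : ℂ) := by
  rw [EuclideanSpace.real_norm_sq_eq]
  simp [dirDeriv_apply, pderiv_linForm, sq]

theorem evalAt_dirDeriv_self {l : ℕ} {h : MvPolynomial (Fin D) ℂ} (hh : h.IsHomogeneous l)
    (w : Space D) : evalAt (dirDeriv w h) w = l * evalAt h w := by
  simpa [evalAt_sum, evalAt_mul, dirDeriv_apply, evalAt] using
    congrArg (fun p => evalAt p w) hh.sum_X_mul_pderiv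

theorem pderiv_comm (i j : Fin D) (p : MvPolynomial (Fin D) ℂ) :
    pderiv i (pderiv j p) = pderiv j (pderiv i p) := by
  classical
  have bracket_eq_zero : ⁅pderiv (σ := Fin D) (R := ℂ) i, pderiv (σ := Fin D) (R := ℂ) j⁆ = 0 := by
    refine derivation_ext fun k => ?_
    simp only [Derivation.commutator_apply, pderiv_X, Pi.single_apply, Derivation.zero_apply]
    split_ifs <;> simp
  rw [← sub_eq_zero, ← Derivation.commutator_apply, bracket_eq_zero, Derivation.zero_apply]

theorem dirDeriv_mem_harmonicPoly (w : Space D) {l : ℕ} {h : MvPolynomial (Fin D) ℂ}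
    (hh : h ∈ harmonicPoly D (l + 1)) : dirDeriv w h ∈ harmonicPoly D l := by
  obtain ⟨hom, harm⟩ := mem_harmonicPoly_iff.1 hh
  rw [dirDeriv_apply]
  refine Submodule.sum_mem _ fun i _ => ?_
  rw [← smul_eq_C_mul]
  refine Submodule.smul_mem _ _ (mem_harmonicPoly_iff.2 ⟨hom.pderiv, ?_⟩)
  rw [polyLaplacian_apply] at harm ⊢
  simp only [pderiv_comm _ i, ← map_sum, harm, map_zero]

theorem gaussMoment_linForm_pow_add_two (w : Space D) (m : ℕ) :
    gaussMoment D (linForm w ^ (m + 2)) =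
      ((m + 1 : ℕ) * ‖w‖ ^ 2 : ℝ) * gaussMoment D (linForm w ^ m) := by
  have moment_linForm_mul (p : MvPolynomial (Fin D) ℂ) :
      gaussMoment D (linForm w * p) = gaussMoment D (dirDeriv w p) := by
    simp only [linForm, dirDeriv_apply, Finset.sum_mul, map_sum, ← smul_eq_C_mul, smul_mul_assoc,
      map_smul, gaussMoment_X_mul]
  rw [pow_succ', moment_linForm_mul, Derivation.leibniz_pow, dirDeriv_linForm, smul_eq_mul,
    Nat.add_sub_cancel, mul_comm (linForm w ^ m), ← smul_eq_C_mul, map_nsmul, map_smul]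
  simp [mul_assoc]

theorem gaussMoment_linForm_pow_even (w : Space D) (n : ℕ) :
    gaussMoment D (linForm w ^ (2 * n)) =
      ((2 * Real.pi) ^ ((D : ℝ) / 2) * ((2 * n).factorial / (2 ^ n * n.factorial)) *
        ‖w‖ ^ (2 * n) : ℝ) := by
  induction n with
  | zero => simp [gaussMoment_apply, evalAt, integral_gaussWeight]
  | succ n ih =>
    rw [mul_add_one, gaussMoment_linForm_pow_add_two, ih, ← Complex.ofReal_mul,
      Nat.factorial_succ (2 * n + 1), Nat.factorial_succ (2 * n), Nat.factorial_succ n]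
    congr 1
    push_cast
    field_simp
    ring

theorem gaussMoment_linForm_pow_odd (w : Space D) (n : ℕ) :
    gaussMoment D (linForm w ^ (2 * n + 1)) = 0 := by
  induction n with
  | zero =>
    simp only [mul_zero, zero_add, pow_one, linForm, map_sum, ← smul_eq_C_mul, map_smul]
    refine Finset.sum_eq_zero fun i _ => ?_
    rw [← mul_one (X i), gaussMoment_X_mul, Derivation.map_one_eq_zero, map_zero, smul_zero]
  | succ n ih =>
    rw [show 2 * (n + 1) + 1 = 2 * n + 1 + 2 by ring, gaussMoment_linForm_pow_add_two, ih, mul_zero]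

-- Euler's identity writes `l h` as `∑ i, x_i ∂_i h`; integrating by parts in each summand leaves
-- the derivatives of `(w · x) ^ m`, because those of `∂_i h` add up to the Laplacian of `h`.
theorem mul_gaussMoment_linForm_pow_mul_harmonic (w : Space D) (m : ℕ) {l : ℕ}
    {h : MvPolynomial (Fin D) ℂ} (hh : h ∈ harmonicPoly D l) :
    l * gaussMoment D (linForm w ^ m * h) =
      m * gaussMoment D (linForm w ^ (m - 1) * dirDeriv w h) := by
  obtain ⟨hom, harm⟩ := mem_harmonicPoly_iff.1 hh
  calc l * gaussMoment D (linForm w ^ m * h)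
      = ∑ i, gaussMoment D (X i * (linForm w ^ m * pderiv i h)) := by
        rw [← nsmul_eq_mul, ← map_nsmul, ← mul_smul_comm, ← hom.sum_X_mul_pderiv, Finset.mul_sum,
          map_sum]
        simp only [mul_left_comm]
    _ = gaussMoment D (linForm w ^ m * polyLaplacian D h) +
          ∑ i, gaussMoment D (pderiv i h * pderiv i (linForm w ^ m)) := by
        simp only [gaussMoment_X_mul, Derivation.leibniz, smul_eq_mul, map_add,
          Finset.sum_add_distrib, polyLaplacian_apply, Finset.mul_sum, map_sum]
    _ = m * gaussMoment D (linForm w ^ (m - 1) * dirDeriv w h) := by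
        rw [harm, mul_zero, map_zero, zero_add, dirDeriv_apply, Finset.mul_sum, map_sum,
          ← nsmul_eq_mul, Finset.smul_sum]
        refine Finset.sum_congr rfl fun i _ => ?_
        rw [← map_nsmul, Derivation.leibniz_pow, pderiv_linForm, smul_eq_mul]
        congr 1
        simp only [nsmul_eq_mul]
        ring

theorem gaussMoment_linForm_pow_mul_harmonic (w : Space D) {l : ℕ} (m : ℕ)
    {h : MvPolynomial (Fin D) ℂ} (hh : h ∈ harmonicPoly D l) :
    gaussMoment D (linForm w ^ m * h) =
      m.descFactorial l * evalAt h w * gaussMoment D (linForm w ^ (m - l)) := by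
  induction l generalizing m h with
  | zero =>
    obtain ⟨c, rfl⟩ := exists_eq_C_of_isHomogeneous_zero (mem_harmonicPoly_iff.1 hh).1
    rw [mul_comm, ← smul_eq_C_mul, map_smul]
    simp
  | succ l ih =>
    have recursion := mul_gaussMoment_linForm_pow_mul_harmonic w m hh
    rw [ih (m - 1) (dirDeriv_mem_harmonicPoly w hh),
      evalAt_dirDeriv_self (mem_harmonicPoly_iff.1 hh).1] at recursion
    refine mul_left_cancel₀ (by exact_mod_cast l.succ_ne_zero : ((l + 1 : ℕ) : ℂ) ≠ 0)
      (recursion.trans ?_)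
    cases m with
    | zero => simp
    | succ m =>
      simp only [Nat.succ_descFactorial_succ, Nat.add_sub_add_right, Nat.add_sub_cancel]
      push_cast
      ring

end GaussianMoments

section PolarCoordinates

open Module

theorem integral_volumeIoiPow {F : Type*} [NormedAddCommGroup F] [NormedSpace ℝ F] (n : ℕ)
    (f : ℝ → F) :
    ∫ r : Set.Ioi (0 : ℝ), f r ∂Measure.volumeIoiPow n = ∫ r in Set.Ioi (0 : ℝ), r ^ n • f r := by
  simp only [Measure.volumeIoiPow, ENNReal.ofReal]
  rw [integral_withDensity_eq_integral_smul (measurable_subtype_coe.pow_const _).real_toNNReal,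
    integral_subtype_comap measurableSet_Ioi fun r => Real.toNNReal (r ^ n) • f r]
  refine setIntegral_congr_fun measurableSet_Ioi fun r hr => ?_
  rw [NNReal.smul_def, Real.coe_toNNReal _ (pow_nonneg (le_of_lt hr) _)]

variable {E F : Type*} [NormedAddCommGroup E] [NormedSpace ℝ E]

theorem comp_homeomorphUnitSphereProd (f : E → F) :
    (fun p : Metric.sphere (0 : E) 1 × Set.Ioi (0 : ℝ) => f ((p.2 : ℝ) • (p.1 : E))) ∘
      homeomorphUnitSphereProd E = f ∘ Subtype.val := by
  funext x
  simp [smul_smul, norm_ne_zero_iff.2 x.2]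

variable [FiniteDimensional ℝ E] [MeasurableSpace E] [BorelSpace E] {μ : Measure E}
  [μ.IsAddHaarMeasure] [NormedAddCommGroup F]

theorem integrable_polar {f : E → F} (hf : Integrable f μ) :
    Integrable (fun p : Metric.sphere (0 : E) 1 × Set.Ioi (0 : ℝ) => f ((p.2 : ℝ) • (p.1 : E)))
      (μ.toSphere.prod (Measure.volumeIoiPow (finrank ℝ E - 1))) := by
  rw [← μ.measurePreserving_homeomorphUnitSphereProd.integrable_comp_emb
      (Homeomorph.measurableEmbedding _), comp_homeomorphUnitSphereProd,
    ← integrableOn_iff_comap_subtypeVal (measurableSet_singleton _).compl]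
  exact hf.integrableOn

theorem integral_polar [Nontrivial E] [NormedSpace ℝ F] {f : E → F} (hf : Integrable f μ) :
    ∫ x, f x ∂μ = ∫ r in Set.Ioi (0 : ℝ),
      r ^ (finrank ℝ E - 1) • ∫ θ : Metric.sphere (0 : E) 1, f (r • (θ : E)) ∂μ.toSphere := by
  have on_product := μ.measurePreserving_homeomorphUnitSphereProd.integral_comp
    (Homeomorph.measurableEmbedding _)
    fun p : Metric.sphere (0 : E) 1 × Set.Ioi (0 : ℝ) => f ((p.2 : ℝ) • (p.1 : E))
  have restrict_ne_zero := integral_congr_ae (μ := μ.comap Subtype.val)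
    (ae_of_all _ (congrFun (comp_homeomorphUnitSphereProd f)))
  simp only [Function.comp_apply] at restrict_ne_zero
  rw [restrict_ne_zero, integral_subtype_comap (measurableSet_singleton _).compl f,
    restrict_compl_singleton, integral_prod_symm _ (integrable_polar hf)] at on_product
  exact on_product.trans (integral_volumeIoiPow _
    fun r => ∫ θ : Metric.sphere (0 : E) 1, f (r • (θ : E)) ∂μ.toSphere)

end PolarCoordinates

section SphereMoments

open MvPolynomial

variable {D : ℕ}

/-- The surface measure of the unit sphere of `ℝ^D`. -/
abbrev sphereMeasure (D : ℕ) : Measure (Metric.sphere (0 : Space D) 1) :=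
  (volume : Measure (Space D)).toSphere

theorem nontrivial_space (hD : 1 ≤ D) : Nontrivial (Space D) :=
  have : Nonempty (Fin D) := ⟨⟨0, hD⟩⟩
  inferInstance

/-- The moment `∫₀^∞ r^n exp(-r²/2) dr` in closed form. -/
def radialMoment (n : ℕ) : ℝ := 2 ^ (((n : ℝ) + 1) / 2 - 1) * Real.Gamma (((n : ℝ) + 1) / 2)

theorem radialMoment_pos (n : ℕ) : 0 < radialMoment n :=
  mul_pos (by positivity) (Real.Gamma_pos_of_pos (by positivity))

theorem integral_pow_mul_exp (n : ℕ) :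
    ∫ r in Set.Ioi (0 : ℝ), r ^ n * Real.exp (-(1 / 2) * r ^ 2) = radialMoment n := by
  have rpow_moment := integral_rpow_mul_exp_neg_mul_rpow (p := 2) (q := n) (b := 1 / 2)
    (by norm_num) (by linarith [(n.cast_nonneg : (0 : ℝ) ≤ n)]) (by norm_num)
  simp only [Real.rpow_natCast, Real.rpow_ofNat] at rpow_moment
  rw [rpow_moment, radialMoment, Real.rpow_sub_one (by norm_num), one_div,
    Real.inv_rpow (by norm_num), neg_div, Real.rpow_neg (by norm_num), inv_inv]
  ring

theorem gaussMoment_eq_radialMoment_mul (hD : 1 ≤ D) {m : ℕ} {p : MvPolynomial (Fin D) ℂ}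
    (hp : p.IsHomogeneous m) :
    gaussMoment D p = radialMoment (D - 1 + m) *
      ∫ θ : Metric.sphere (0 : Space D) 1, evalAt p θ ∂sphereMeasure D := by
  have := nontrivial_space hD
  have gaussWeight_polar (r : ℝ) (θ : Metric.sphere (0 : Space D) 1) :
      gaussWeight (r • (θ : Space D)) = (Real.exp (-(1 / 2) * r ^ 2) : ℝ) := by
    simp [gaussWeight, norm_smul]
  rw [gaussMoment_apply, integral_polar (integrable_evalAt_mul_gaussWeight p),
    ← integral_pow_mul_exp, ← integral_complex_ofReal, ← integral_mul_const]
  refine setIntegral_congr_fun measurableSet_Ioi fun r _ => ?_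
  simp only [evalAt_real_smul hp, gaussWeight_polar, integral_mul_const, integral_const_mul,
    finrank_euclideanSpace_fin, Complex.real_smul]
  push_cast
  ring

end SphereMoments

section PlaneWaves

open MvPolynomial

variable {D : ℕ}

theorem isHomogeneous_linForm (w : Space D) : (linForm w).IsHomogeneous 1 :=
  IsHomogeneous.sum _ _ _ fun i _ => by
    simpa using (isHomogeneous_C (Fin D) (w i : ℂ)).mul (isHomogeneous_X ℂ i)

theorem continuous_evalAt_sphere (p : MvPolynomial (Fin D) ℂ) :
    Continuous fun θ : Metric.sphere (0 : Space D) 1 => evalAt p θ :=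
  (continuous_evalAt p).comp continuous_subtype_val

theorem exists_norm_evalAt_sphere_le (p : MvPolynomial (Fin D) ℂ) :
    ∃ C : ℝ, ∀ θ : Metric.sphere (0 : Space D) 1, ‖evalAt p θ‖ ≤ C := by
  obtain ⟨C, hC⟩ := isCompact_univ.exists_bound_of_continuousOn
    (continuous_evalAt_sphere p).continuousOn
  exact ⟨C, fun θ => hC θ trivial⟩

theorem gaussMoment_linForm_pow_mul_eq_radialMoment_mul (hD : 1 ≤ D) (w : Space D) (m : ℕ) {l : ℕ}
    {h : MvPolynomial (Fin D) ℂ} (hh : h ∈ harmonicPoly D l) :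
    gaussMoment D (linForm w ^ m * h) = radialMoment (D - 1 + (m + l)) *
      ∫ θ : Metric.sphere (0 : Space D) 1, evalAt (linForm w ^ m * h) θ ∂sphereMeasure D :=
  gaussMoment_eq_radialMoment_mul hD
    (by simpa using ((isHomogeneous_linForm w).pow m).mul (mem_harmonicPoly_iff.1 hh).1)

theorem integral_sphere_linForm_pow_mul_harmonic (hD : 1 ≤ D) (w : Space D) {l : ℕ}
    {h : MvPolynomial (Fin D) ℂ} (hh : h ∈ harmonicPoly D l) (n : ℕ) :
    ∫ θ : Metric.sphere (0 : Space D) 1, evalAt (linForm w ^ (l + 2 * n) * h) θ ∂sphereMeasure D =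
      ((2 * Real.pi) ^ ((D : ℝ) / 2) * ((l + 2 * n).factorial * ‖w‖ ^ (2 * n) /
        (2 ^ n * n.factorial * radialMoment (D - 1 + (l + 2 * n + l)))) : ℝ) * evalAt h w := by
  have moment_eq := gaussMoment_linForm_pow_mul_eq_radialMoment_mul hD w (l + 2 * n) hh
  rw [gaussMoment_linForm_pow_mul_harmonic w _ hh, Nat.add_sub_cancel_left,
    gaussMoment_linForm_pow_even] at moment_eq
  have descFactorial_mul : ((2 * n).factorial : ℂ) * (l + 2 * n).descFactorial l =
      (l + 2 * n).factorial := by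
    exact_mod_cast Nat.add_sub_cancel_left (n := l) (m := 2 * n) ▸
      Nat.factorial_mul_descFactorial (Nat.le_add_right l (2 * n))
  have radialMoment_ne_zero : (radialMoment (D - 1 + (l + 2 * n + l)) : ℂ) ≠ 0 :=
    Complex.ofReal_ne_zero.2 (radialMoment_pos _).ne'
  rw [← mul_right_inj' radialMoment_ne_zero, ← moment_eq]
  push_cast
  rw [← descFactorial_mul]
  field_simp

theorem integral_sphere_linForm_pow_mul_harmonic_eq_zero (hD : 1 ≤ D) (w : Space D) {l : ℕ}
    {h : MvPolynomial (Fin D) ℂ} (hh : h ∈ harmonicPoly D l) {m : ℕ} (hm : ∀ n, l + 2 * n ≠ m) :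
    ∫ θ : Metric.sphere (0 : Space D) 1, evalAt (linForm w ^ m * h) θ ∂sphereMeasure D = 0 := by
  have moment_eq := gaussMoment_linForm_pow_mul_eq_radialMoment_mul hD w m hh
  rw [gaussMoment_linForm_pow_mul_harmonic w _ hh] at moment_eq
  have moment_eq_zero :
      m.descFactorial l * evalAt h w * gaussMoment D (linForm w ^ (m - l)) = 0 := by
    rcases lt_or_ge m l with hml | hlm
    · simp [Nat.descFactorial_of_lt hml]
    · obtain ⟨n, hn | hn⟩ := Nat.even_or_odd' (m - l)
      · exact absurd (by omega) (hm n)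
      · rw [hn, gaussMoment_linForm_pow_odd, mul_zero]
  exact (mul_eq_zero.1 (moment_eq.symm.trans moment_eq_zero)).resolve_left
    (Complex.ofReal_ne_zero.2 (radialMoment_pos _).ne')

theorem hasSum_integral_sphere_exp (c : ℂ) (w : Space D) (p : MvPolynomial (Fin D) ℂ) :
    HasSum (fun m : ℕ => c ^ m / m.factorial *
        ∫ θ : Metric.sphere (0 : Space D) 1, evalAt (linForm w ^ m * p) θ ∂sphereMeasure D)
      (∫ θ : Metric.sphere (0 : Space D) 1,
        Complex.exp (c * (inner ℝ (θ : Space D) w : ℝ)) * evalAt p θ ∂sphereMeasure D) := by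
  obtain ⟨C, hC⟩ := exists_norm_evalAt_sphere_le p
  have integrand_eq (m : ℕ) (θ : Metric.sphere (0 : Space D) 1) :
      c ^ m / m.factorial * evalAt (linForm w ^ m * p) θ =
        (c * (inner ℝ (θ : Space D) w : ℝ)) ^ m / m.factorial * evalAt p θ := by
    rw [evalAt_mul, evalAt_pow, evalAt_linForm]
    ring
  simp only [← integral_const_mul, integrand_eq]
  refine hasSum_integral_of_dominated_convergence
    (fun m _ => (‖c‖ * ‖w‖) ^ m / m.factorial * C) (fun m => ?_) (fun m => ae_of_all _ fun θ => ?_)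
    (ae_of_all _ fun _ => (Real.summable_pow_div_factorial _).mul_right C) (integrable_const _)
    (ae_of_all _ fun θ => ?_)
  · have := continuous_evalAt_sphere p
    exact Continuous.aestronglyMeasurable (by fun_prop)
  · have norm_exponent_le : ‖c * (inner ℝ (θ : Space D) w : ℝ)‖ ≤ ‖c‖ * ‖w‖ := by
      rw [norm_mul, Complex.norm_real]
      gcongr
      simpa using norm_inner_le_norm (𝕜 := ℝ) (θ : Space D) w
    rw [norm_mul, norm_div, norm_pow, Complex.norm_natCast]
    gcongr
    exact hC θ
  · have exp_series := NormedSpace.expSeries_div_hasSum_exp (c * (inner ℝ (θ : Space D) w : ℝ))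
    rw [← Complex.exp_eq_exp_ℂ] at exp_series
    exact exp_series.mul_right _

/-- The even entire function `x^{-ν-1/2} J_{ν+1/2}(x)`, the power series factor of
`riccatiBessel`. -/
def besselSeries (ν x : ℝ) : ℝ :=
  ∑' n : ℕ, (-x ^ 2 / 2) ^ n /
    ((n.factorial : ℝ) * 2 ^ ((n : ℝ) + ν + 1 / 2) * Real.Gamma (ν + (n : ℝ) + 3 / 2))

theorem radialMoment_eq (hD : 1 ≤ D) (l n : ℕ) {ν : ℝ} (hν : ν = l + ((D : ℝ) - 3) / 2) :
    radialMoment (D - 1 + (l + 2 * n + l)) =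
      2 ^ ((n : ℝ) + ν + 1 / 2) * Real.Gamma (ν + (n : ℝ) + 3 / 2) := by
  rw [radialMoment, hν]
  push_cast [hD]
  ring_nf

theorem integral_sphere_exp_mul_harmonic (hD : 1 ≤ D) (k : ℝ) (z : Space D) {l : ℕ}
    {h : MvPolynomial (Fin D) ℂ} (hh : h ∈ harmonicPoly D l) :
    ∫ θ : Metric.sphere (0 : Space D) 1,
        Complex.exp (Complex.I * k * (inner ℝ (θ : Space D) z : ℝ)) * evalAt h θ ∂sphereMeasure D =
      ((2 * Real.pi) ^ ((D : ℝ) / 2) : ℝ) * (Complex.I * k) ^ l *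
        besselSeries (l + ((D : ℝ) - 3) / 2) (k * ‖z‖) * evalAt h z := by
  have injective_degree : Function.Injective fun n : ℕ => l + 2 * n := fun m n hmn => by
    simpa using hmn
  have series := (injective_degree.hasSum_iff fun m hm => by
    rw [integral_sphere_linForm_pow_mul_harmonic_eq_zero hD z hh fun n hn => hm ⟨n, hn⟩,
      mul_zero]).2 (hasSum_integral_sphere_exp (Complex.I * k) z h)
  rw [← series.tsum_eq, besselSeries, Complex.ofReal_tsum, ← tsum_mul_left, ← tsum_mul_right]
  refine tsum_congr fun n => ?_
  have I_pow : Complex.I ^ (2 * n) = (-1) ^ n := by rw [pow_mul, Complex.I_sq]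
  have factorial_ne_zero : ((l + 2 * n).factorial : ℂ) ≠ 0 := by
    exact_mod_cast (l + 2 * n).factorial_ne_zero
  rw [Function.comp_apply, integral_sphere_linForm_pow_mul_harmonic hD z hh,
    radialMoment_eq hD l n rfl]
  push_cast
  rw [neg_div, neg_pow, pow_add, mul_pow _ _ (2 * n), I_pow, div_pow, ← pow_mul,
    mul_pow _ _ (2 * n)]
  field_simp

theorem sphereArea_pos (hD : 1 ≤ D) : 0 < sphereArea D :=
  have : (0 : ℝ) < D := by exact_mod_cast hD
  div_pos (by positivity) (Real.Gamma_pos_of_pos (by positivity))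

theorem eigenstate_eq (B : SphericalHarmonics D) {a E : ℝ} (hE : 0 < E) (α : Channel D)
    {z : Space D} (hz : z ≠ 0) :
    eigenstate B a E α z = (sphereArea D ^ (-(1 / 2) : ℝ) * (E ^ (1 / a)) ^ α.1 *
      besselSeries (α.1 + ((D : ℝ) - 3) / 2) (E ^ (1 / a) * ‖z‖) : ℝ) *
        evalAt (B.basis α.1 α.2 : MvPolynomial (Fin D) ℂ) z := by
  have norm_pos : 0 < ‖z‖ := norm_pos_iff.2 hz
  have hk : 0 < E ^ (1 / a) := Real.rpow_pos_of_pos hE _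
  rw [eigenstate]
  generalize E ^ (1 / a) = k at hk ⊢
  have evalAt_z := evalAt_real_smul (mem_harmonicPoly_iff.1 (B.basis α.1 α.2).2).1 ‖z‖ (‖z‖⁻¹ • z)
  rw [smul_smul, mul_inv_cancel₀ norm_pos.ne', one_smul] at evalAt_z
  have power_eq : (k * ‖z‖) ^ (-((D : ℝ) - 1) / 2) *
      (k * ‖z‖) ^ ((α.1 : ℝ) + ((D : ℝ) - 3) / 2 + 1) = k ^ α.1 * ‖z‖ ^ α.1 := by
    rw [← Real.rpow_add (by positivity), ← mul_pow, ← Real.rpow_natCast]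
    ring_nf
  have sqrt_mul_sqrt : √(2 / Real.pi) * √(Real.pi / 2) = 1 := by
    rw [← inv_div, Real.sqrt_inv, inv_mul_cancel₀ (by positivity)]
  rw [evalAt_z, SphericalHarmonics.Y, ← mul_assoc, ← Complex.ofReal_pow,
    ← Complex.ofReal_mul, riccatiBessel, ← besselSeries]
  congr 2
  linear_combination (sphereArea D ^ (-(1 / 2) : ℝ) * besselSeries _ (k * ‖z‖)) *
    (√(2 / Real.pi) * √(Real.pi / 2) * power_eq + k ^ α.1 * ‖z‖ ^ α.1 * sqrt_mul_sqrt)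

theorem integral_sphere_exp_mul_Y (hD : 1 ≤ D) (B : SphericalHarmonics D) {a E : ℝ} (hE : 0 < E)
    (α : Channel D) {z : Space D} (hz : z ≠ 0) :
    ∫ θ : Metric.sphere (0 : Space D) 1,
        Complex.exp (Complex.I * (E ^ (1 / a) : ℝ) * (inner ℝ (θ : Space D) z : ℝ)) *
          B.Y α θ ∂sphereMeasure D =
      Complex.I ^ α.1 * ((2 * Real.pi) ^ ((D : ℝ) / 2) * √(sphereArea D) : ℝ) *
        eigenstate B a E α z := by
  have sqrt_mul_rpow : (√(sphereArea D) : ℂ) * (sphereArea D ^ (-(1 / 2) : ℝ) : ℝ) = 1 := by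
    rw [Real.sqrt_eq_rpow, ← Complex.ofReal_mul, ← Real.rpow_add (sphereArea_pos hD)]
    simp
  simp only [SphericalHarmonics.Y]
  rw [integral_sphere_exp_mul_harmonic hD _ z (B.basis α.1 α.2).2, eigenstate_eq B hE α hz]
  push_cast
  rw [mul_pow]
  linear_combination (-((2 * Real.pi) ^ ((D : ℝ) / 2) : ℝ) * Complex.I ^ α.1 *
    ((E ^ (1 / a) : ℝ) : ℂ) ^ α.1 * besselSeries (α.1 + ((D : ℝ) - 3) / 2) (E ^ (1 / a) * ‖z‖) *
    evalAt (B.basis α.1 α.2 : MvPolynomial (Fin D) ℂ) z) * sqrt_mul_rpow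

end PlaneWaves

section Parseval

open MvPolynomial

variable {D : ℕ}

/-- Restriction of polynomials to the unit sphere, as continuous functions. -/
def sphereRestrict (D : ℕ) : MvPolynomial (Fin D) ℂ →ₐ[ℂ] C(Metric.sphere (0 : Space D) 1, ℂ) :=
  aeval fun i => ⟨fun θ => (((θ : Space D) i : ℝ) : ℂ), by fun_prop⟩

theorem sphereRestrict_apply (p : MvPolynomial (Fin D) ℂ) (θ : Metric.sphere (0 : Space D) 1) :
    sphereRestrict D p θ = evalAt p θ := by
  induction p using MvPolynomial.induction_on with
  | C c => simp [sphereRestrict, Algebra.algebraMap_eq_smul_one]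
  | add p q hp hq => simp [evalAt_add, hp, hq]
  | mul_X p i hp =>
    rw [map_mul, ContinuousMap.mul_apply, hp, evalAt_mul]
    simp [sphereRestrict]

theorem sphereRestrict_sqRadius : sphereRestrict D (sqRadius D) = 1 := by
  ext θ
  rw [sphereRestrict_apply, evalAt_sqRadius]
  simp

theorem star_sphereRestrict_mem_range (p : MvPolynomial (Fin D) ℂ) :
    star (sphereRestrict D p) ∈ (sphereRestrict D).range := by
  induction p using MvPolynomial.induction_on with
  | C c =>
    refine ⟨C (star c), ?_⟩
    ext θ
    simp [sphereRestrict, Algebra.algebraMap_eq_smul_one]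
  | add p q hp hq => simpa using add_mem hp hq
  | mul_X p i hp =>
    rw [map_mul, star_mul']
    refine mul_mem hp ⟨X i, ?_⟩
    ext θ
    simp [sphereRestrict]

/-- The restrictions of polynomials to the sphere, as the star subalgebra to which the
Stone–Weierstrass theorem applies. -/
def sphereStarSubalgebra (D : ℕ) : StarSubalgebra ℂ C(Metric.sphere (0 : Space D) 1, ℂ) where
  toSubalgebra := (sphereRestrict D).range
  star_mem' := by
    rintro _ ⟨p, rfl⟩
    exact star_sphereRestrict_mem_range p

theorem topologicalClosure_sphereStarSubalgebra :
    (sphereStarSubalgebra D).topologicalClosure = ⊤ := by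
  refine ContinuousMap.starSubalgebra_topologicalClosure_eq_top_of_separatesPoints _
    fun θ θ' hne => ?_
  obtain ⟨i, hi⟩ : ∃ i, (θ : Space D) i ≠ (θ' : Space D) i := by
    by_contra! heq
    exact hne (Subtype.ext (PiLp.ext heq))
  refine ⟨sphereRestrict D (X i), ⟨_, ⟨X i, rfl⟩, rfl⟩, ?_⟩
  simpa [sphereRestrict_apply] using hi

namespace SphericalHarmonics

/-- The spherical harmonic `Y_α` as a continuous function on the sphere. -/
def toContinuousMap (B : SphericalHarmonics D) (α : Channel D) :
    C(Metric.sphere (0 : Space D) 1, ℂ) :=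
  sphereRestrict D (B.basis α.1 α.2 : MvPolynomial (Fin D) ℂ)

variable (B : SphericalHarmonics D)

theorem toContinuousMap_apply (α : Channel D) (θ : Metric.sphere (0 : Space D) 1) :
    B.toContinuousMap α θ = B.Y α θ :=
  sphereRestrict_apply _ _

theorem sphereRestrict_harmonicPoly_mem_span {l : ℕ} {h : MvPolynomial (Fin D) ℂ}
    (hh : h ∈ harmonicPoly D l) :
    sphereRestrict D h ∈ Submodule.span ℂ (Set.range B.toContinuousMap) := by
  have expansion := congrArg Subtype.val ((B.basis l).sum_repr ⟨h, hh⟩)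
  simp only [AddSubmonoidClass.coe_finsetSum, Submodule.coe_smul] at expansion
  rw [← expansion, map_sum]
  refine Submodule.sum_mem _ fun q _ => ?_
  rw [map_smul]
  exact Submodule.smul_mem _ _ (Submodule.subset_span ⟨⟨l, q⟩, rfl⟩)

theorem sphereRestrict_mem_span (hD : 1 ≤ D) (p : MvPolynomial (Fin D) ℂ) :
    sphereRestrict D p ∈ Submodule.span ℂ (Set.range B.toContinuousMap) := by
  have radialHarmonicSpan_le (m : ℕ) : radialHarmonicSpan D m ≤
      (Submodule.span ℂ (Set.range B.toContinuousMap)).comap (sphereRestrict D).toLinearMap := by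
    refine Submodule.span_le.2 ?_
    rintro _ ⟨j, l, -, h, hh, rfl⟩
    simpa [sphereRestrict_sqRadius] using B.sphereRestrict_harmonicPoly_mem_span hh
  rw [← sum_homogeneousComponent p, map_sum]
  exact Submodule.sum_mem _ fun m _ => radialHarmonicSpan_le m
    (mem_radialHarmonicSpan hD m (homogeneousComponent_isHomogeneous m p))

theorem topologicalClosure_span_toContinuousMap (hD : 1 ≤ D) :
    (Submodule.span ℂ (Set.range B.toContinuousMap)).topologicalClosure = ⊤ := by
  have polynomials_le : Subalgebra.toSubmodule (sphereStarSubalgebra D).toSubalgebra ≤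
      Submodule.span ℂ (Set.range B.toContinuousMap) := by
    rintro _ ⟨p, rfl⟩
    exact B.sphereRestrict_mem_span hD p
  refine top_le_iff.1 (le_trans ?_ (Submodule.topologicalClosure_mono polynomials_le))
  exact (congrArg (fun A => Subalgebra.toSubmodule (StarSubalgebra.toSubalgebra A))
    (topologicalClosure_sphereStarSubalgebra (D := D))).ge

/-- `Y_α` as an element of `L²` of the sphere. -/
def toL2 (α : Channel D) : Lp ℂ 2 (sphereMeasure D) :=
  ContinuousMap.toLp (E := ℂ) 2 (sphereMeasure D) ℂ (B.toContinuousMap α)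

theorem orthonormal_toL2 : Orthonormal ℂ B.toL2 := by
  rw [orthonormal_iff_ite]
  intro α β
  rw [toL2, toL2, ContinuousMap.inner_toLp, ← B.orthonormal α β]
  refine integral_congr_ae (ae_of_all _ fun θ => ?_)
  simp only [B.toContinuousMap_apply]
  exact mul_comm _ _

/-- The spherical harmonics as a Hilbert basis of `L²` of the sphere. -/
def hilbertBasis (hD : 1 ≤ D) : HilbertBasis (Channel D) ℂ (Lp ℂ 2 (sphereMeasure D)) :=
  HilbertBasis.mk B.orthonormal_toL2 <| by
    have dense_span := (ContinuousMap.toLp_denseRange ℂ (sphereMeasure D) ℂ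
      (p := 2) (by simp)).topologicalClosure_map_submodule
        (B.topologicalClosure_span_toContinuousMap hD)
    rw [Submodule.map_span, ← Set.range_comp] at dense_span
    exact dense_span.ge

theorem coe_hilbertBasis (hD : 1 ≤ D) : ⇑(B.hilbertBasis hD) = B.toL2 :=
  HilbertBasis.coe_mk _ _

theorem hasSum_sq_norm_integral_mul_star_Y (hD : 1 ≤ D)
    (f : C(Metric.sphere (0 : Space D) 1, ℂ)) :
    HasSum (fun α : Channel D => ‖∫ θ, f θ * star (B.Y α θ) ∂sphereMeasure D‖ ^ 2)
      (∫ θ, ‖f θ‖ ^ 2 ∂sphereMeasure D) := by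
  let fL2 : Lp ℂ 2 (sphereMeasure D) := ContinuousMap.toLp (E := ℂ) 2 (sphereMeasure D) ℂ f
  have inner_mul_inner (α : Channel D) :
      inner ℂ fL2 (B.hilbertBasis hD α) * inner ℂ (B.hilbertBasis hD α) fL2 =
        ((‖∫ θ, f θ * star (B.Y α θ) ∂sphereMeasure D‖ ^ 2 : ℝ) : ℂ) := by
    rw [← inner_conj_symm, RCLike.conj_mul, coe_hilbertBasis, toL2, ContinuousMap.inner_toLp]
    simp [B.toContinuousMap_apply]
  have inner_self : inner ℂ fL2 fL2 = ((∫ θ, ‖f θ‖ ^ 2 ∂sphereMeasure D : ℝ) : ℂ) := by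
    rw [ContinuousMap.inner_toLp, ← integral_complex_ofReal]
    refine integral_congr_ae (ae_of_all _ fun θ => ?_)
    simp [Complex.mul_conj, Complex.normSq_eq_norm_sq]
  have parseval := (B.hilbertBasis hD).hasSum_inner_mul_inner fL2 fL2
  simp only [inner_mul_inner, inner_self] at parseval
  exact Complex.hasSum_ofReal.1 parseval

end SphericalHarmonics

end Parseval

section ChannelCoupling

variable {D : ℕ}

theorem norm_exp_neg_I_mul (x : ℝ) : ‖Complex.exp (-Complex.I * x)‖ = 1 := by
  simpa [mul_comm] using Complex.norm_exp_ofReal_mul_I (-x)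

theorem IsFourierPair.continuous {V Vt : Space D → ℂ} (h : IsFourierPair V Vt) :
    Continuous V := by
  rw [funext h.2]
  refine continuous_const.mul (continuous_of_dominated (bound := fun z => ‖Vt z‖)
    (fun k => ?_) (fun k => ae_of_all _ fun z => ?_) h.1.norm (ae_of_all _ fun z => ?_))
  · exact (Continuous.aestronglyMeasurable (by fun_prop)).mul h.1.1
  · rw [norm_mul, norm_exp_neg_I_mul, one_mul]
  · fun_prop

theorem integral_sphere_exp_neg_mul_star_Y (hD : 1 ≤ D) (B : SphericalHarmonics D) {a E : ℝ}
    (hE : 0 < E) (α : Channel D) {z : Space D} (hz : z ≠ 0) :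
    ∫ θ : Metric.sphere (0 : Space D) 1,
        Complex.exp (-Complex.I * (inner ℝ (E ^ (1 / a) • (θ : Space D)) z : ℝ)) *
          star (B.Y α θ) ∂sphereMeasure D =
      star (Complex.I ^ α.1) * ((2 * Real.pi) ^ ((D : ℝ) / 2) * √(sphereArea D) : ℝ) *
        star (eigenstate B a E α z) := by
  have conjugate := congrArg (starRingEnd ℂ) (integral_sphere_exp_mul_Y (a := a) hD B hE α hz)
  rw [← integral_conj] at conjugate
  simp only [map_mul, Complex.conj_ofReal, ← Complex.exp_conj, Complex.conj_I] at conjugate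
  simp only [real_inner_smul_left, Complex.ofReal_mul, ← mul_assoc, ← starRingEnd_apply]
    at conjugate ⊢
  exact conjugate

theorem integrable_exp_neg_mul_star_Y (B : SphericalHarmonics D) (α : Channel D) (k : ℝ)
    {f : Space D → ℂ} (hf : Integrable f) :
    Integrable (fun p : Metric.sphere (0 : Space D) 1 × Space D =>
        Complex.exp (-Complex.I * (inner ℝ (k • (p.1 : Space D)) p.2 : ℝ)) *
          star (B.Y α p.1) * f p.2)
      ((sphereMeasure D).prod volume) := by
  have hY : Continuous fun θ : Metric.sphere (0 : Space D) 1 => star (B.Y α θ) :=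
    (continuous_evalAt_sphere _).star
  simp only [mul_assoc]
  refine ((hY.integrable_of_hasCompactSupport (HasCompactSupport.of_compactSpace _)).mul_prod
    hf).bdd_mul (c := 1) (Continuous.aestronglyMeasurable (by fun_prop)) (ae_of_all _ fun p => ?_)
  rw [norm_exp_neg_I_mul]

theorem integral_sphere_mul_star_Y (hD : 1 ≤ D) (B : SphericalHarmonics D) {V Vt : Space D → ℂ}
    (h : IsFourierPair V Vt) (a : ℝ) {E : ℝ} (hE : 0 < E) (α : Channel D) :
    ∫ θ : Metric.sphere (0 : Space D) 1, V (E ^ (1 / a) • (θ : Space D)) * star (B.Y α θ)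
        ∂sphereMeasure D =
      star (Complex.I ^ α.1) * √(sphereArea D) * channelCoupling B a Vt E α := by
  have := nontrivial_space hD
  set c : ℝ := (2 * Real.pi) ^ (-(D : ℝ) / 2) with hc
  have normalization : (c : ℂ) * ((2 * Real.pi) ^ ((D : ℝ) / 2) : ℝ) = 1 := by
    rw [← Complex.ofReal_mul, hc, ← Real.rpow_add (by positivity)]
    ring_nf
    simp
  calc ∫ θ : Metric.sphere (0 : Space D) 1, V (E ^ (1 / a) • (θ : Space D)) * star (B.Y α θ)
        ∂sphereMeasure D
      = ∫ θ : Metric.sphere (0 : Space D) 1, ((c : ℂ) * ∫ z,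
          Complex.exp (-Complex.I * (inner ℝ (E ^ (1 / a) • (θ : Space D)) z : ℝ)) *
            star (B.Y α θ) * Vt z) ∂sphereMeasure D := by
        refine integral_congr_ae (ae_of_all _ fun θ => ?_)
        simp only [h.2, mul_right_comm _ (star (B.Y α θ)), integral_mul_const]
        exact mul_assoc _ _ _
    _ = c * ∫ z, (∫ θ : Metric.sphere (0 : Space D) 1,
          Complex.exp (-Complex.I * (inner ℝ (E ^ (1 / a) • (θ : Space D)) z : ℝ)) *
            star (B.Y α θ) ∂sphereMeasure D) * Vt z := by
        rw [integral_const_mul, integral_integral_swap (integrable_exp_neg_mul_star_Y B α _ h.1)]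
        simp only [integral_mul_const]
    _ = c * ∫ z, star (Complex.I ^ α.1) * ((2 * Real.pi) ^ ((D : ℝ) / 2) * √(sphereArea D) : ℝ) *
          (Vt z * star (eigenstate B a E α z)) := by
        congr 1
        refine integral_congr_ae ?_
        filter_upwards [Measure.ae_ne volume (0 : Space D)] with z hz
        rw [integral_sphere_exp_neg_mul_star_Y hD B hE α hz]
        ring
    _ = star (Complex.I ^ α.1) * √(sphereArea D) * channelCoupling B a Vt E α := by
        rw [integral_const_mul, ← channelCoupling]
        push_cast at normalization ⊢
        linear_combination (star (Complex.I ^ α.1) * (√(sphereArea D) : ℂ) *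
          channelCoupling B a Vt E α) * normalization

theorem hasSum_sq_norm_channelCoupling (hD : 1 ≤ D) (B : SphericalHarmonics D)
    {V Vt : Space D → ℂ} (h : IsFourierPair V Vt) (a : ℝ) {E : ℝ} (hE : 0 < E) :
    HasSum (fun α : Channel D => sphereArea D * ‖channelCoupling B a Vt E α‖ ^ 2)
      (∫ θ : Metric.sphere (0 : Space D) 1, ‖V (E ^ (1 / a) • (θ : Space D))‖ ^ 2
        ∂sphereMeasure D) := by
  have hV : Continuous fun θ : Metric.sphere (0 : Space D) 1 => V (E ^ (1 / a) • (θ : Space D)) :=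
    h.continuous.comp (by fun_prop)
  have parseval := B.hasSum_sq_norm_integral_mul_star_Y hD ⟨_, hV⟩
  simp only [ContinuousMap.coe_mk, integral_sphere_mul_star_Y hD B h a hE] at parseval
  refine parseval.congr_fun fun α => ?_
  rw [norm_mul, norm_mul, norm_star, norm_pow, Complex.norm_I, one_pow, one_mul, mul_pow,
    Complex.norm_real, Real.norm_eq_abs, sq_abs, Real.sq_sqrt (sphereArea_pos hD).le]

end ChannelCoupling

section WienerAlgebra

open scoped FourierTransform SchwartzMap

/-- Membership in the Wiener algebra of the line: continuous integrable functions whose Fourier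
transform is integrable. This is the regularity under which `∫ f(x) / (x₀ - x + iε) dx` has a limit
as `ε → 0⁺`. -/
structure InWienerAlgebra (f : ℝ → ℂ) : Prop where
  continuous : Continuous f
  integrable : Integrable f
  integrable_fourier : Integrable (𝓕 f)

/-- The superposition `r ↦ ∫ exp(-2πi r τ(x)) g(x) dμ(x)` of plane waves with frequencies `τ(x)` and
amplitudes `g(x)`. -/
def waveSum {X : Type*} [MeasurableSpace X] (μ : Measure X) (g : X → ℂ) (τ : X → ℝ) (r : ℝ) : ℂ :=
  ∫ x, 𝐞 (-(r * τ x)) • g x ∂μ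

variable {X : Type*} [MeasurableSpace X] {μ : Measure X} {g : X → ℂ} {τ : X → ℝ}

theorem integrable_fourierChar_smul {f : X → ℂ} (hf : Integrable f μ) {θ : X → ℝ}
    (hθ : Measurable θ) : Integrable (fun x => 𝐞 (θ x) • f x) μ :=
  hf.mono ((Measurable.aestronglyMeasurable (by fun_prop)).smul hf.1)
    (ae_of_all _ fun x => by simp)

theorem norm_waveSum_le (g : X → ℂ) (τ : X → ℝ) (r : ℝ) :
    ‖waveSum μ g τ r‖ ≤ ∫ x, ‖g x‖ ∂μ :=
  (norm_integral_le_integral_norm _).trans_eq (by simp)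

theorem continuous_waveSum (hg : Integrable g μ) (hτ : Measurable τ) :
    Continuous (waveSum μ g τ) := by
  refine continuous_of_dominated (bound := fun x => ‖g x‖) (fun r => ?_)
    (fun r => ae_of_all _ fun x => by simp) hg.norm (ae_of_all _ fun x => by fun_prop)
  exact (Measurable.aestronglyMeasurable (by fun_prop)).smul hg.1

theorem fourier_mul_waveSum [SFinite μ] {φ : ℝ → ℂ} (hφ : Integrable φ) (hg : Integrable g μ)
    (hτ : Measurable τ) (s : ℝ) :
    𝓕 (fun r => φ r * waveSum μ g τ r) s = ∫ x, g x * 𝓕 φ (s + τ x) ∂μ := by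
  have integrable_prod : Integrable
      (fun p : ℝ × X => 𝐞 (-(p.1 * (s + τ p.2))) • (φ p.1 * g p.2)) (volume.prod μ) :=
    integrable_fourierChar_smul (hφ.mul_prod hg) (by fun_prop)
  calc 𝓕 (fun r => φ r * waveSum μ g τ r) s
      = ∫ r, ∫ x, 𝐞 (-(r * (s + τ x))) • (φ r * g x) ∂μ := by
        rw [Real.fourier_real_eq]
        refine integral_congr_ae (ae_of_all _ fun r => ?_)
        simp only [waveSum, ← integral_const_mul, Circle.smul_def, smul_eq_mul]
        refine integral_congr_ae (ae_of_all _ fun x => ?_)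
        simp only [mul_add, neg_add, AddChar.map_add_eq_mul, Circle.coe_mul]
        ring
    _ = ∫ x, (∫ r, 𝐞 (-(r * (s + τ x))) • (φ r * g x)) ∂μ := integral_integral_swap integrable_prod
    _ = ∫ x, g x * 𝓕 φ (s + τ x) ∂μ := by
        refine integral_congr_ae (ae_of_all _ fun x => ?_)
        simp only [Real.fourier_real_eq, ← integral_const_mul, Circle.smul_def, smul_eq_mul]
        refine integral_congr_ae (ae_of_all _ fun r => ?_)
        ring

theorem inWienerAlgebra_mul_waveSum [SFinite μ] (φ : 𝓢(ℝ, ℂ)) (hg : Integrable g μ)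
    (hτ : Measurable τ) : InWienerAlgebra fun r => φ r * waveSum μ g τ r where
  continuous := φ.continuous.mul (continuous_waveSum hg hτ)
  integrable := φ.integrable.mul_bdd (c := ∫ x, ‖g x‖ ∂μ)
    (continuous_waveSum hg hτ).aestronglyMeasurable (ae_of_all _ (norm_waveSum_le g τ))
  integrable_fourier := by
    rw [funext (fourier_mul_waveSum φ.integrable hg hτ)]
    have shear : MeasurePreserving (fun p : X × ℝ => (p.1, p.2 + τ p.1))
        (μ.prod volume) (μ.prod volume) :=
      (MeasurePreserving.id μ).skew_product (g := fun x s => s + τ x) (by fun_prop)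
        (ae_of_all _ fun x => map_add_right_eq_self volume (τ x))
    have fourier_integrable : Integrable (𝓕 (φ : ℝ → ℂ)) := (𝓕 φ).integrable
    exact (shear.integrable_comp_of_integrable (hg.mul_prod fourier_integrable)).integral_prod_right

theorem integral_exp_smul_fourierChar {ε : ℝ} (hε : 0 < ε) (y : ℝ) :
    ∫ s in Set.Ioi (0 : ℝ), 𝐞 (s * y) • (Real.exp (-2 * Real.pi * ε * s) : ℂ) =
      Complex.I / (2 * Real.pi * (y + ε * Complex.I)) := by
  have exponent_re_neg : (2 * Real.pi * (y * Complex.I - ε) : ℂ).re < 0 := by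
    simpa using mul_pos Real.two_pi_pos hε
  have denominator_ne_zero : (y + ε * Complex.I : ℂ) ≠ 0 := fun h => by
    simpa [hε.ne'] using congrArg Complex.im h
  have integrand_eq (s : ℝ) : 𝐞 (s * y) • (Real.exp (-2 * Real.pi * ε * s) : ℂ) =
      Complex.exp (2 * Real.pi * (y * Complex.I - ε) * s) := by
    rw [Circle.smul_def, smul_eq_mul, Real.fourierChar_apply, Complex.ofReal_exp, ← Complex.exp_add]
    push_cast
    ring_nf
  simp only [integrand_eq, integral_exp_mul_complex_Ioi exponent_re_neg, Complex.ofReal_zero,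
    mul_zero, Complex.exp_zero]
  have rotate : (y * Complex.I - ε : ℂ) = Complex.I * (y + ε * Complex.I) := by
    linear_combination (-ε : ℂ) * Complex.I_sq
  rw [rotate, div_eq_div_iff (by simp [Real.pi_ne_zero, denominator_ne_zero])
    (by simp [Real.pi_ne_zero, denominator_ne_zero])]
  linear_combination (-2 * Real.pi * (y + ε * Complex.I)) * Complex.I_sq

theorem integral_div_sub_add_mul_I {f : ℝ → ℂ} (hf : Integrable f) (x₀ : ℝ) {ε : ℝ} (hε : 0 < ε) :
    ∫ x, f x / (((x₀ - x : ℝ) : ℂ) + ε * Complex.I) = -(2 * Real.pi * Complex.I) *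
      ∫ s in Set.Ioi (0 : ℝ), Real.exp (-2 * Real.pi * ε * s) • 𝐞 (s * x₀) • 𝓕 f s := by
  have exp_integrable : IntegrableOn (fun s => Real.exp (-2 * Real.pi * ε * s)) (Set.Ioi 0) := by
    simpa [mul_assoc] using exp_neg_integrableOn_Ioi 0 (b := 2 * Real.pi * ε) (by positivity)
  have integrable_prod : Integrable (fun p : ℝ × ℝ =>
      𝐞 (p.2 * (x₀ - p.1)) • (f p.1 * (Real.exp (-2 * Real.pi * ε * p.2) : ℂ)))
      (volume.prod (volume.restrict (Set.Ioi 0))) :=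
    integrable_fourierChar_smul (hf.mul_prod exp_integrable.ofReal) (by fun_prop)
  calc ∫ x, f x / (((x₀ - x : ℝ) : ℂ) + ε * Complex.I)
      = ∫ x, -(2 * Real.pi * Complex.I) * ∫ s in Set.Ioi (0 : ℝ),
          𝐞 (s * (x₀ - x)) • (f x * (Real.exp (-2 * Real.pi * ε * s) : ℂ)) := by
        refine integral_congr_ae (ae_of_all _ fun x => ?_)
        have kernel := integral_exp_smul_fourierChar hε (x₀ - x)
        simp only [Circle.smul_def, smul_eq_mul, mul_left_comm _ (f x), integral_const_mul]
          at kernel ⊢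
        rw [kernel]
        push_cast
        field_simp
        simp [neg_div]
    _ = -(2 * Real.pi * Complex.I) * ∫ s in Set.Ioi (0 : ℝ), ∫ x,
          𝐞 (s * (x₀ - x)) • (f x * (Real.exp (-2 * Real.pi * ε * s) : ℂ)) := by
        rw [integral_const_mul, integral_integral_swap integrable_prod]
    _ = _ := by
        congr 1
        refine setIntegral_congr_fun measurableSet_Ioi fun s _ => ?_
        simp only [Real.fourier_real_eq, Circle.smul_def, smul_eq_mul, Complex.real_smul,
          ← integral_const_mul]
        refine integral_congr_ae (ae_of_all _ fun x => ?_)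
        have phase_split : (𝐞 (s * (x₀ - x)) : ℂ) = 𝐞 (s * x₀) * 𝐞 (-(x * s)) := by
          rw [← Circle.coe_mul, ← AddChar.map_add_eq_mul]
          ring_nf
        simp only [phase_split]
        ring

namespace InWienerAlgebra

theorem tendsto_integral_div {f : ℝ → ℂ} (hf : InWienerAlgebra f) (x₀ : ℝ) :
    Tendsto (fun ε : ℝ => ∫ x, f x / (((x₀ - x : ℝ) : ℂ) + ε * Complex.I)) (𝓝[>] 0)
      (𝓝 (-(2 * Real.pi * Complex.I) * ∫ s in Set.Ioi (0 : ℝ), 𝐞 (s * x₀) • 𝓕 f s)) := by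
  have modulated_integrable : Integrable fun s => 𝐞 (s * x₀) • 𝓕 f s :=
    integrable_fourierChar_smul hf.integrable_fourier (by fun_prop)
  have continuous_exp (s : ℝ) : Continuous fun ε : ℝ => Real.exp (-2 * Real.pi * ε * s) := by
    fun_prop
  refine Tendsto.congr' (eventually_nhdsWithin_of_forall fun ε hε =>
    (integral_div_sub_add_mul_I hf.integrable x₀ hε).symm) (Tendsto.const_mul _ ?_)
  refine tendsto_integral_filter_of_dominated_convergence (fun s => ‖𝐞 (s * x₀) • 𝓕 f s‖)
    (Eventually.of_forall fun ε => ?_) (eventually_nhdsWithin_of_forall fun ε hε => ?_)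
    modulated_integrable.norm.integrableOn (ae_of_all _ fun s => ?_)
  · have continuous_weight : Continuous fun s : ℝ => Real.exp (-2 * Real.pi * ε * s) := by fun_prop
    exact continuous_weight.aestronglyMeasurable.smul modulated_integrable.1.restrict
  · filter_upwards [ae_restrict_mem measurableSet_Ioi] with s hs
    rw [norm_smul, Real.norm_eq_abs, Real.abs_exp]
    have exponent_nonneg : 0 ≤ 2 * Real.pi * ε * s :=
      mul_nonneg (mul_nonneg Real.two_pi_pos.le (le_of_lt hε)) (le_of_lt hs)
    exact mul_le_of_le_one_left (norm_nonneg _) (Real.exp_le_one_iff.2 (by linarith))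
  · simpa using (((continuous_exp s).tendsto 0).mono_left nhdsWithin_le_nhds).smul_const
      (𝐞 (s * x₀) • 𝓕 f s)

theorem two_mul_re_integral_fourier {g : ℝ → ℝ} (hg : InWienerAlgebra fun x => (g x : ℂ))
    (x₀ : ℝ) :
    2 * (∫ s in Set.Ioi (0 : ℝ), 𝐞 (s * x₀) • 𝓕 (fun x => (g x : ℂ)) s).re = g x₀ := by
  set F : ℝ → ℂ := fun s => 𝐞 (s * x₀) • 𝓕 (fun x => (g x : ℂ)) s with hF
  have F_integrable : Integrable F :=
    integrable_fourierChar_smul hg.integrable_fourier (by fun_prop)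
  have F_neg (s : ℝ) : F (-s) = starRingEnd ℂ (F s) := by
    simp only [hF, Real.fourier_real_eq, Circle.smul_def, smul_eq_mul, map_mul, ← integral_conj,
      Complex.conj_ofReal, ← Circle.coe_inv_eq_conj, ← AddChar.map_neg_eq_inv]
    ring_nf
  have inversion : ∫ s, F s = g x₀ := by
    rw [← congrFun (hg.continuous.fourierInv_fourier_eq hg.integrable hg.integrable_fourier) x₀,
      Real.fourierInv_eq]
    simp only [hF, RCLike.inner_apply, conj_trivial, mul_comm x₀]
  have lower_half : ∫ s in Set.Iic (0 : ℝ), F s = starRingEnd ℂ (∫ s in Set.Ioi (0 : ℝ), F s) := by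
    simp only [← integral_conj, ← F_neg, integral_comp_neg_Ioi, neg_zero]
  rw [← intervalIntegral.integral_Iic_add_Ioi F_integrable.integrableOn F_integrable.integrableOn,
    lower_half, add_comm, Complex.add_conj] at inversion
  exact_mod_cast inversion

theorem exists_tendsto_integral_div {g : ℝ → ℝ} (hg : InWienerAlgebra fun x => (g x : ℂ))
    (x₀ : ℝ) {c : ℝ} (hc : 0 < c) :
    ∃ L : ℂ, Tendsto (fun η : ℝ => ∫ x, (g x : ℂ) / (((c * (x₀ - x) : ℝ) : ℂ) + η * Complex.I))
      (𝓝[>] 0) (𝓝 L) ∧ L.im = -Real.pi * g x₀ / c := by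
  have scale : Tendsto (fun η : ℝ => η / c) (𝓝[>] 0) (𝓝[>] 0) := by
    refine tendsto_nhdsWithin_iff.2 ⟨?_, eventually_nhdsWithin_of_forall fun η hη => div_pos hη hc⟩
    simpa using ((continuous_id.div_const c).tendsto 0).mono_left nhdsWithin_le_nhds
  have hc_ne_zero : (c : ℂ) ≠ 0 := Complex.ofReal_ne_zero.2 hc.ne'
  refine ⟨_, (((hg.tendsto_integral_div x₀).comp scale).const_mul (c : ℂ)⁻¹).congr fun η => ?_, ?_⟩
  · rw [Function.comp_apply, ← integral_const_mul]
    refine integral_congr_ae (ae_of_all _ fun x => ?_)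
    beta_reduce
    rw [← div_eq_inv_mul, div_div]
    congr 1
    push_cast
    field_simp
  · rw [← hg.two_mul_re_integral_fourier x₀, ← Complex.ofReal_inv, Complex.im_ofReal_mul]
    simp only [neg_mul, Complex.neg_im, Complex.mul_im, Complex.mul_re, Complex.re_ofNat,
      Complex.im_ofNat, Complex.ofReal_re, Complex.ofReal_im, Complex.I_re, Complex.I_im]
    ring

end InWienerAlgebra

end WienerAlgebra

section BoundaryIntegrals

variable {X : Type*} [MeasurableSpace X] {μ : Measure X}

theorem abs_re_le_norm_add_mul_I (p η : ℝ) : |p| ≤ ‖(p + η * Complex.I : ℂ)‖ := by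
  simpa using Complex.abs_re_le_norm (p + η * Complex.I)

theorem abs_im_le_norm_add_mul_I (p η : ℝ) : |η| ≤ ‖(p + η * Complex.I : ℂ)‖ := by
  simpa using Complex.abs_im_le_norm (p + η * Complex.I)

theorem add_mul_I_ne_zero (p : ℝ) {η : ℝ} (hη : η ≠ 0) : (p + η * Complex.I : ℂ) ≠ 0 :=
  norm_pos_iff.1 ((abs_pos.2 hη).trans_le (abs_im_le_norm_add_mul_I p η))

theorem tendsto_inv_add_mul_I {p : ℝ} (hp : p ≠ 0) :
    Tendsto (fun η : ℝ => (p + η * Complex.I : ℂ)⁻¹) (𝓝[>] 0) (𝓝 (p : ℂ)⁻¹) := by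
  have shift : Tendsto (fun η : ℝ => (p + η * Complex.I : ℂ)) (𝓝 0) (𝓝 (p : ℂ)) := by
    simpa using (show Continuous fun η : ℝ => (p + η * Complex.I : ℂ) by fun_prop).tendsto 0
  exact (shift.mono_left nhdsWithin_le_nhds).inv₀ (Complex.ofReal_ne_zero.2 hp)

theorem integrable_div_add_mul_I {f : X → ℂ} (hf : Integrable f μ) {p : X → ℝ}
    (hp : Measurable p) {η : ℝ} (hη : η ≠ 0) :
    Integrable (fun x => f x / (p x + η * Complex.I)) μ := by
  refine hf.mul_bdd (c := |η|⁻¹) (Measurable.aestronglyMeasurable (by fun_prop))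
    (ae_of_all _ fun x => ?_)
  rw [norm_inv]
  exact inv_anti₀ (abs_pos.2 hη) (abs_im_le_norm_add_mul_I _ _)

theorem norm_div_add_mul_I_le {f p : ℝ} (hf_zero : p = 0 → f = 0) (η : ℝ) :
    ‖(f : ℂ) / (p + η * Complex.I)‖ ≤ ‖f / p‖ := by
  by_cases hp : p = 0
  · simp [hf_zero hp]
  rw [norm_div, norm_div, Complex.norm_real]
  exact div_le_div_of_nonneg_left (norm_nonneg _) (abs_pos.2 hp) (abs_re_le_norm_add_mul_I _ _)

theorem aestronglyMeasurable_div_add_mul_I {f p : X → ℝ} (hf : AEStronglyMeasurable f μ)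
    (hp : Measurable p) (η : ℝ) :
    AEStronglyMeasurable (fun x => (f x : ℂ) / (p x + η * Complex.I)) μ :=
  (Complex.continuous_ofReal.comp_aestronglyMeasurable hf).mul
    (Measurable.aestronglyMeasurable (by fun_prop))

theorem integrable_div_add_mul_I_of_integrable_div {f p : X → ℝ} (hf : AEStronglyMeasurable f μ)
    (hp : Measurable p) (hfp : Integrable (fun x => f x / p x) μ)
    (hf_zero : ∀ x, p x = 0 → f x = 0) (η : ℝ) :
    Integrable (fun x => (f x : ℂ) / (p x + η * Complex.I)) μ :=
  hfp.norm.mono' (aestronglyMeasurable_div_add_mul_I hf hp η)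
    (ae_of_all _ fun x => norm_div_add_mul_I_le (hf_zero x) η)

theorem tendsto_integral_div_add_mul_I {f p : X → ℝ} (hf : AEStronglyMeasurable f μ)
    (hp : Measurable p) (hfp : Integrable (fun x => f x / p x) μ)
    (hf_zero : ∀ x, p x = 0 → f x = 0) :
    Tendsto (fun η : ℝ => ∫ x, (f x : ℂ) / (p x + η * Complex.I) ∂μ) (𝓝[>] 0)
      (𝓝 ((∫ x, f x / p x ∂μ : ℝ) : ℂ)) := by
  rw [← integral_complex_ofReal]
  refine tendsto_integral_filter_of_dominated_convergence (fun x => ‖f x / p x‖)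
    (Eventually.of_forall fun η => aestronglyMeasurable_div_add_mul_I hf hp η)
    (Eventually.of_forall fun η => ae_of_all _ fun x => norm_div_add_mul_I_le (hf_zero x) η)
    hfp.norm (ae_of_all _ fun x => ?_)
  by_cases hpx : p x = 0
  · simp [hf_zero x hpx]
  simpa only [div_eq_mul_inv, Complex.ofReal_mul, Complex.ofReal_inv] using
    (tendsto_inv_add_mul_I hpx).const_mul (f x : ℂ)

theorem norm_inv_sub_inv_le {p q B η : ℝ} (hη : η ≠ 0) (hB : 0 ≤ B)
    (hquad : |q - p| ≤ B * q ^ 2) (hhalf : |q - p| ≤ |q| / 2) :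
    ‖(p + η * Complex.I : ℂ)⁻¹ - (q + η * Complex.I : ℂ)⁻¹‖ ≤ 2 * B := by
  have p_ne := add_mul_I_ne_zero p hη
  have q_ne := add_mul_I_ne_zero q hη
  have half_le_abs : |q| / 2 ≤ |p| := by
    linarith [abs_sub_abs_le_abs_sub q p]
  have product_lower : |q| / 2 * |q| ≤ ‖(p + η * Complex.I : ℂ)‖ * ‖(q + η * Complex.I : ℂ)‖ :=
    mul_le_mul (half_le_abs.trans (abs_re_le_norm_add_mul_I p η)) (abs_re_le_norm_add_mul_I q η)
      (abs_nonneg q) (norm_nonneg _)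
  rw [inv_sub_inv p_ne q_ne, add_sub_add_right_eq_sub, ← Complex.ofReal_sub, norm_div, norm_mul,
    Complex.norm_real, Real.norm_eq_abs,
    div_le_iff₀ (mul_pos (norm_pos_iff.2 p_ne) (norm_pos_iff.2 q_ne))]
  calc |q - p| ≤ B * q ^ 2 := hquad
    _ = 2 * B * (|q| / 2 * |q|) := by rw [← sq_abs]; ring
    _ ≤ _ := by gcongr

theorem tendsto_integral_mul_inv_sub_inv {g p q : X → ℝ} (hg : Integrable g μ)
    (hp : Measurable p) (hq : Measurable q) {B : ℝ} (hB : 0 ≤ B)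
    (hquad : ∀ x, g x ≠ 0 → |q x - p x| ≤ B * q x ^ 2)
    (hhalf : ∀ x, g x ≠ 0 → |q x - p x| ≤ |q x| / 2) :
    Tendsto (fun η : ℝ =>
        ∫ x, (g x : ℂ) * ((p x + η * Complex.I)⁻¹ - (q x + η * Complex.I)⁻¹) ∂μ) (𝓝[>] 0)
      (𝓝 ((∫ x, g x * ((p x)⁻¹ - (q x)⁻¹) ∂μ : ℝ) : ℂ)) := by
  rw [← integral_complex_ofReal]
  refine tendsto_integral_filter_of_dominated_convergence (fun x => ‖g x‖ * (2 * B))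
    (Eventually.of_forall fun η => ?_)
    (eventually_nhdsWithin_of_forall fun η hη => ae_of_all _ fun x => ?_)
    (hg.norm.mul_const _) (ae_of_all _ fun x => ?_)
  · exact hg.ofReal.1.mul (Measurable.aestronglyMeasurable (by fun_prop))
  · by_cases hgx : g x = 0
    · simp [hgx]
    rw [norm_mul, Complex.norm_real]
    gcongr
    exact norm_inv_sub_inv_le (ne_of_gt hη) hB (hquad x hgx) (hhalf x hgx)
  · by_cases hgx : g x = 0
    · simp [hgx]
    have close := hhalf x hgx
    by_cases hqx : q x = 0
    · have hpx : p x = 0 := by simpa [hqx] using close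
      simp [hpx, hqx]
    have hpx : p x ≠ 0 := fun hpx => hqx <| by
      rw [hpx, sub_zero] at close
      exact abs_eq_zero.1 (by linarith [abs_nonneg (q x)])
    simpa using ((tendsto_inv_add_mul_I hpx).sub (tendsto_inv_add_mul_I hqx)).const_mul (g x : ℂ)

theorem InWienerAlgebra.exists_tendsto_integral_div_of_linearization {g : ℝ → ℝ}
    (hg : InWienerAlgebra fun x => (g x : ℂ)) {p : ℝ → ℝ} (hp : Measurable p) {x₀ c B : ℝ}
    (hc : 0 < c) (hB : 0 ≤ B)
    (hquad : ∀ x, g x ≠ 0 → |c * (x₀ - x) - p x| ≤ B * (c * (x₀ - x)) ^ 2)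
    (hhalf : ∀ x, g x ≠ 0 → |c * (x₀ - x) - p x| ≤ |c * (x₀ - x)| / 2) :
    ∃ L : ℂ, Tendsto (fun η : ℝ => ∫ x, (g x : ℂ) / (p x + η * Complex.I)) (𝓝[>] 0) (𝓝 L) ∧
      L.im = -Real.pi * g x₀ / c := by
  obtain ⟨L, linear_tendsto, L_im⟩ := hg.exists_tendsto_integral_div x₀ hc
  have hg_integrable : Integrable g := by simpa using hg.integrable.re
  have correction := tendsto_integral_mul_inv_sub_inv hg_integrable hp
    (by fun_prop : Measurable fun x => c * (x₀ - x)) hB hquad hhalf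
  refine ⟨_, (linear_tendsto.add correction).congr' ?_, by simpa using L_im⟩
  filter_upwards [self_mem_nhdsWithin] with η hη
  have linear_integrable := integrable_div_add_mul_I hg.integrable
    (by fun_prop : Measurable fun x => c * (x₀ - x)) (ne_of_gt hη)
  simp only [mul_sub (g _ : ℂ), ← div_eq_mul_inv]
  rw [integral_sub (integrable_div_add_mul_I hg.integrable hp (ne_of_gt hη)) linear_integrable,
    add_sub_cancel]

theorem isBigO_sub_sub_deriv_mul {f : ℝ → ℝ} {x₀ : ℝ} (hf : AnalyticAt ℝ f x₀) :
    (fun x => f x - f x₀ - deriv f x₀ * (x - x₀)) =O[𝓝 x₀] fun x => (x - x₀) ^ 2 := by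
  obtain ⟨s, hs⟩ := hf
  have recenter : Tendsto (fun x => x - x₀) (𝓝 x₀) (𝓝 0) := by
    simpa using (continuous_sub_right x₀).tendsto x₀
  refine ((hs.isBigO_sub_partialSum_pow 2).comp_tendsto recenter).congr (fun x => ?_) fun x => ?_
  · have constant_term : s.coeff 0 = f x₀ := hs.coeff_zero 1
    simp only [FormalMultilinearSeries.partialSum, FormalMultilinearSeries.apply_eq_prod_smul_coeff,
      Fin.prod_const, smul_eq_mul, Finset.sum_range_succ, Finset.sum_range_zero, constant_term,
      Function.comp_apply, add_sub_cancel, hs.deriv]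
    ring
  · simp

theorem exists_eventually_abs_linearization_sub_le {p : ℝ → ℝ} {x₀ c : ℝ}
    (hp : AnalyticAt ℝ p x₀) (hp_zero : p x₀ = 0) (hp_deriv : deriv p x₀ = -c) (hc : c ≠ 0) :
    ∃ B, 0 ≤ B ∧ ∀ᶠ x in 𝓝 x₀, |c * (x₀ - x) - p x| ≤ B * (c * (x₀ - x)) ^ 2 ∧
      |c * (x₀ - x) - p x| ≤ |c * (x₀ - x)| / 2 := by
  obtain ⟨C, hC⟩ := (isBigO_sub_sub_deriv_mul hp).bound
  have taylor : ∀ᶠ x in 𝓝 x₀, |c * (x₀ - x) - p x| ≤ |C| / c ^ 2 * (c * (x₀ - x)) ^ 2 := by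
    filter_upwards [hC] with x hx
    rw [hp_zero, hp_deriv, Real.norm_eq_abs, Real.norm_eq_abs, abs_sq, ← abs_neg] at hx
    calc |c * (x₀ - x) - p x| = |-(p x - 0 - -c * (x - x₀))| := by ring_nf
      _ ≤ |C| * (x - x₀) ^ 2 := hx.trans (by gcongr; exact le_abs_self C)
      _ = |C| / c ^ 2 * (c * (x₀ - x)) ^ 2 := by field_simp; ring
  have small : ∀ᶠ x in 𝓝 x₀, |C| / c ^ 2 * |c * (x₀ - x)| < 1 / 2 :=
    (Continuous.tendsto (by fun_prop) x₀).eventually_lt_const (by simp)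
  refine ⟨|C| / c ^ 2, by positivity, ?_⟩
  filter_upwards [taylor, small] with x hx hx_small
  refine ⟨hx, hx.trans ?_⟩
  rw [← sq_abs (c * (x₀ - x))]
  nlinarith [abs_nonneg (c * (x₀ - x))]

end BoundaryIntegrals

section SelfEnergy

open scoped FourierTransform ContDiff

variable {D : ℕ} {V Vt : Space D → ℂ} {a E : ℝ}

/-- The mass of `|V|²` on the shell `|k| = r`, normalized to the unit sphere: the Jacobian
`r ^ (D - 1)` is left out, which makes it a superposition of plane waves in `r ∈ ℝ`. -/
def shellMass (V : Space D → ℂ) (r : ℝ) : ℝ :=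
  ∫ θ : Metric.sphere (0 : Space D) 1, ‖V (r • (θ : Space D))‖ ^ 2 ∂sphereMeasure D

/-- The amplitude of the pair of positions `(z, z')` in the representation of `|V|²` as a Fourier
integral over pairs of positions. -/
def pairAmplitude (Vt : Space D → ℂ) (q : Space D × Space D) : ℂ :=
  ((((2 * Real.pi) ^ (-(D : ℝ) / 2)) : ℝ) : ℂ) * Vt q.1 *
    star (((((2 * Real.pi) ^ (-(D : ℝ) / 2)) : ℝ) : ℂ) * Vt q.2)

theorem IsFourierPair.integrable_pairAmplitude (h : IsFourierPair V Vt) :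
    Integrable (pairAmplitude Vt) := by
  have scaled := h.1.const_mul ((((2 * Real.pi) ^ (-(D : ℝ) / 2)) : ℝ) : ℂ)
  exact scaled.mul_prod (scaled.congr' (continuous_star.comp_aestronglyMeasurable scaled.1)
    (ae_of_all _ fun z => (norm_star _).symm))

theorem fourierChar_inner_sub (k q q' : Space D) :
    (𝐞 (-(inner ℝ k (q - q') / (2 * Real.pi))) : ℂ) =
      Complex.exp (-Complex.I * (inner ℝ k q : ℝ)) *
        star (Complex.exp (-Complex.I * (inner ℝ k q' : ℝ))) := by
  rw [← starRingEnd_apply, ← Complex.exp_conj, ← Complex.exp_add, Real.fourierChar_apply,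
    inner_sub_right]
  congr 1
  have := Complex.ofReal_ne_zero.2 Real.pi_ne_zero
  simp only [map_neg, map_mul, Complex.conj_I, Complex.conj_ofReal]
  push_cast
  field_simp
  ring

theorem IsFourierPair.sq_norm_eq_integral (h : IsFourierPair V Vt) (k : Space D) :
    ((‖V k‖ ^ 2 : ℝ) : ℂ) =
      ∫ q, 𝐞 (-(inner ℝ k (q.1 - q.2) / (2 * Real.pi))) • pairAmplitude Vt q := by
  rw [Complex.ofReal_pow, ← Complex.mul_conj', starRingEnd_apply, h.2 k, ← integral_const_mul,
    ← starRingEnd_apply, ← integral_conj, ← integral_prod_mul]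
  refine integral_congr_ae (ae_of_all _ fun q => ?_)
  simp only [Circle.smul_def, smul_eq_mul, fourierChar_inner_sub, pairAmplitude, map_mul,
    star_mul', starRingEnd_apply]
  ring

theorem IsFourierPair.waveSum_eq_shellMass (h : IsFourierPair V Vt) (r : ℝ) :
    waveSum ((sphereMeasure D).prod volume)
      (fun x : Metric.sphere (0 : Space D) 1 × (Space D × Space D) => pairAmplitude Vt x.2)
      (fun x => inner ℝ (x.1 : Space D) (x.2.1 - x.2.2) / (2 * Real.pi)) r = shellMass V r := by
  rw [waveSum, integral_prod _ (integrable_fourierChar_smul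
    (h.integrable_pairAmplitude.comp_snd _) (Continuous.measurable (by fun_prop))), shellMass,
    ← integral_complex_ofReal]
  refine integral_congr_ae (ae_of_all _ fun θ => ?_)
  simp only [h.sq_norm_eq_integral, real_inner_smul_left, mul_div_assoc]

theorem IsFourierPair.inWienerAlgebra_mul_shellMass (h : IsFourierPair V Vt) {φ : ℝ → ℝ}
    (hφ : HasCompactSupport φ) (hφ_smooth : ContDiff ℝ ∞ φ) :
    InWienerAlgebra fun r => ((φ r * shellMass V r : ℝ) : ℂ) := by
  have : SFinite ((sphereMeasure D).prod (volume : Measure (Space D × Space D))) :=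
    Measure.prod.instSFinite
  have hφ_complex : HasCompactSupport fun r => (φ r : ℂ) := hφ.comp_left Complex.ofReal_zero
  have wave := inWienerAlgebra_mul_waveSum
    (hφ_complex.toSchwartzMap (Complex.ofRealCLM.contDiff.comp hφ_smooth))
    (μ := (sphereMeasure D).prod volume) (h.integrable_pairAmplitude.comp_snd (sphereMeasure D))
    (τ := fun x => inner ℝ (x.1 : Space D) (x.2.1 - x.2.2) / (2 * Real.pi))
    (Continuous.measurable (by fun_prop))
  simp only [h.waveSum_eq_shellMass] at wave
  simp only [Complex.ofReal_mul]
  exact wave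

theorem integral_radial_mul (hD : 1 ≤ D) {f : ℝ → ℂ} {F : Space D → ℂ}
    (hf : Integrable fun k : Space D => f ‖k‖ * F k) :
    ∫ k : Space D, f ‖k‖ * F k = ∫ r in Set.Ioi (0 : ℝ), f r * (r : ℂ) ^ (D - 1) *
      ∫ θ : Metric.sphere (0 : Space D) 1, F (r • (θ : Space D)) ∂sphereMeasure D := by
  have := nontrivial_space hD
  rw [integral_polar hf]
  refine setIntegral_congr_fun measurableSet_Ioi fun r (hr : 0 < r) => ?_
  have norm_eq (θ : Metric.sphere (0 : Space D) 1) : ‖r • (θ : Space D)‖ = r := by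
    rw [norm_smul, norm_eq_of_mem_sphere, mul_one, Real.norm_of_nonneg hr.le]
  simp only [norm_eq, integral_const_mul, finrank_euclideanSpace_fin, Complex.real_smul,
    Complex.ofReal_pow]
  ring

theorem IsFourierPair.integrable_cutoff_mul (h : IsFourierPair V Vt) {φ : ℝ → ℝ}
    (hφ : HasCompactSupport φ) (hφ_cont : Continuous φ) :
    Integrable fun k : Space D => φ ‖k‖ * ‖V k‖ ^ 2 := by
  have hV := h.continuous
  have compactSupport_comp_norm : HasCompactSupport fun k : Space D => φ ‖k‖ := by
    rw [hasCompactSupport_iff_eventuallyEq, coclosedCompact_eq_cocompact] at hφ ⊢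
    exact (tendsto_norm_cocompact_atTop.mono_right atTop_le_cocompact).eventually hφ
  exact Continuous.integrable_of_hasCompactSupport (by fun_prop) compactSupport_comp_norm.mul_right

theorem IsFourierPair.exists_tendsto_integral_near_shell (hD : 1 ≤ D) (h : IsFourierPair V Vt)
    {φ p : ℝ → ℝ} (hφ : HasCompactSupport φ) (hφ_smooth : ContDiff ℝ ∞ φ)
    (hφ_pos : ∀ r, φ r ≠ 0 → 0 < r) (hp : Measurable p) {k₀ c B : ℝ} (hc : 0 < c) (hB : 0 ≤ B)
    (hquad : ∀ r, φ r ≠ 0 → |c * (k₀ - r) - p r| ≤ B * (c * (k₀ - r)) ^ 2)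
    (hhalf : ∀ r, φ r ≠ 0 → |c * (k₀ - r) - p r| ≤ |c * (k₀ - r)| / 2) :
    ∃ L : ℂ, Tendsto (fun η : ℝ => ∫ k : Space D,
        ((φ ‖k‖ * ‖V k‖ ^ 2 : ℝ) : ℂ) / (p ‖k‖ + η * Complex.I)) (𝓝[>] 0) (𝓝 L) ∧
      L.im = -Real.pi * (φ k₀ * k₀ ^ (D - 1) * shellMass V k₀) / c := by
  have radial_inWienerAlgebra := h.inWienerAlgebra_mul_shellMass
    (φ := fun r => φ r * r ^ (D - 1)) hφ.mul_right (hφ_smooth.mul (contDiff_id.pow _))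
  obtain ⟨L, L_tendsto, L_im⟩ :=
    radial_inWienerAlgebra.exists_tendsto_integral_div_of_linearization hp hc hB
      (fun r hr => hquad r fun hφr => hr (by simp [hφr]))
      (fun r hr => hhalf r fun hφr => hr (by simp [hφr]))
  refine ⟨L, L_tendsto.congr' ?_, L_im⟩
  filter_upwards [self_mem_nhdsWithin] with η hη
  have as_radial (k : Space D) :
      ((φ ‖k‖ * ‖V k‖ ^ 2 : ℝ) : ℂ) / (p ‖k‖ + η * Complex.I) =
        φ ‖k‖ / (p ‖k‖ + η * Complex.I) * ((‖V k‖ ^ 2 : ℝ) : ℂ) := by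
    push_cast
    ring
  have cutoff_integrable : Integrable fun k : Space D =>
      φ ‖k‖ / (p ‖k‖ + η * Complex.I) * ((‖V k‖ ^ 2 : ℝ) : ℂ) :=
    (integrable_div_add_mul_I (h.integrable_cutoff_mul hφ hφ_smooth.continuous).ofReal
      (hp.comp measurable_norm) (ne_of_gt hη)).congr (ae_of_all _ as_radial)
  simp only [as_radial]
  rw [integral_radial_mul hD (f := fun r => φ r / (p r + η * Complex.I)) cutoff_integrable,
    setIntegral_eq_integral_of_forall_compl_eq_zero fun r hr => by
      simp [not_imp_comm.1 (hφ_pos r) hr]]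
  refine integral_congr_ae (ae_of_all _ fun r => ?_)
  simp only [shellMass, integral_complex_ofReal]
  push_cast
  ring

end SelfEnergy

section Dispersion

variable {D : ℕ} {V Vt : Space D → ℂ} {a E : ℝ}

theorem exists_one_add_rpow_le_mul_abs_sub (ha : 0 < a) (hE : 0 < E) {ε : ℝ} (hε : 0 < ε) :
    ∃ C, 0 ≤ C ∧ ∀ r, 0 ≤ r → ε ≤ |r - E ^ (1 / a)| → 1 + r ^ a ≤ C * |E - r ^ a| := by
  obtain ⟨d, hd, root_near⟩ := Metric.continuousAt_iff.1
    (Real.continuousAt_rpow_const E (1 / a) (Or.inl hE.ne')) ε hε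
  refine ⟨(1 + E) / d + 1, by positivity, fun r hr off_shell => ?_⟩
  have energy_gap : d ≤ |E - r ^ a| := by
    contrapose! off_shell
    have := root_near (by rwa [Real.dist_eq, abs_sub_comm] : dist (r ^ a) E < d)
    rwa [one_div, Real.rpow_rpow_inv hr ha.ne', ← one_div, Real.dist_eq] at this
  calc 1 + r ^ a = (1 + E) / d * d - (E - r ^ a) := by field_simp; ring
    _ ≤ (1 + E) / d * |E - r ^ a| + |E - r ^ a| := by
      linarith [neg_abs_le (E - r ^ a),
        mul_le_mul_of_nonneg_left energy_gap (by positivity : 0 ≤ (1 + E) / d)]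
    _ = _ := by ring

theorem integrable_mul_div_sub_rpow (ha : 0 < a) (hE : 0 < E) (hV : AEStronglyMeasurable V)
    (hVa : Integrable fun k : Space D => ‖V k‖ ^ 2 / (1 + ‖k‖ ^ a)) {ψ : ℝ → ℝ}
    (hψ : Measurable ψ) (hψ_le : ∀ r, |ψ r| ≤ 1) {ε : ℝ} (hε : 0 < ε)
    (hψ_zero : ∀ r, |r - E ^ (1 / a)| < ε → ψ r = 0) :
    Integrable fun k : Space D => ψ ‖k‖ * ‖V k‖ ^ 2 / (E - ‖k‖ ^ a) := by
  obtain ⟨C, hC, weight_le⟩ := exists_one_add_rpow_le_mul_abs_sub ha hE hε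
  refine (hVa.const_mul C).mono' ?_ (ae_of_all _ fun k => ?_)
  · exact ((hψ.comp measurable_norm).aestronglyMeasurable.mul (hV.norm.pow 2)).mul
      (Measurable.aestronglyMeasurable (by fun_prop))
  have weight_pos : 0 < 1 + ‖k‖ ^ a := by positivity
  by_cases near : |‖k‖ - E ^ (1 / a)| < ε
  · rw [hψ_zero _ near, zero_mul, zero_div, norm_zero]
    positivity
  have off_shell := weight_le _ (norm_nonneg k) (not_lt.1 near)
  have gap_pos : 0 < |E - ‖k‖ ^ a| :=
    pos_of_mul_pos_right (weight_pos.trans_le off_shell) hC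
  rw [norm_div, norm_mul, Real.norm_eq_abs, Real.norm_eq_abs, Real.norm_eq_abs, abs_sq,
    ← mul_div_assoc, div_le_div_iff₀ gap_pos weight_pos]
  calc |ψ ‖k‖| * ‖V k‖ ^ 2 * (1 + ‖k‖ ^ a)
      ≤ 1 * ‖V k‖ ^ 2 * (C * |E - ‖k‖ ^ a|) := by gcongr; exact hψ_le _
    _ = _ := by ring

/-- The self-energy `∫ |V(k)|² / (ω - |k|^a) dk`, the scalar factor of the matrix `K(ω)`. -/
def selfEnergy (a : ℝ) (V : Space D → ℂ) (ω : ℂ) : ℂ :=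
  ∫ k : Space D, ((‖V k‖ ^ 2 : ℝ) : ℂ) / (ω - ((‖k‖ ^ a : ℝ) : ℂ))

/-- The spectral weight of `|V|²` at energy `E`: the shell average of `|V|²` times the density of
states, so that `-π` times it is the imaginary part of the self-energy at `E + i0`. -/
def shellCoupling (a E : ℝ) (V : Space D → ℂ) : ℝ :=
  density D a E / sphereArea D * shellMass V (E ^ (1 / a))

theorem density_div_sphereArea (hD : 1 ≤ D) (ha : 0 < a) (hE : 0 < E) :
    density D a E / sphereArea D =
      (E ^ (1 / a)) ^ (D - 1) / (a * (E ^ (1 / a)) ^ (a - 1)) := by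
  have sphereArea_ne_zero := (sphereArea_pos hD).ne'
  have radius_pow : (E ^ (1 / a)) ^ (D - 1) = E ^ (((D : ℝ) - 1) / a) := by
    rw [← Real.rpow_natCast, ← Real.rpow_mul hE.le]
    congr 1
    push_cast [hD]
    ring
  have energy_rpow :
      E ^ (-1 + (D : ℝ) / a) = E ^ (((D : ℝ) - 1) / a) / (E ^ (1 / a)) ^ (a - 1) := by
    rw [← Real.rpow_mul hE.le, ← Real.rpow_sub hE]
    congr 1
    field_simp
    ring
  rw [density, radius_pow, energy_rpow]
  field_simp

theorem exists_eventually_abs_linearization_rpow_sub_le (ha : 0 < a) (hE : 0 < E) :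
    ∃ B, 0 ≤ B ∧ ∀ᶠ r in 𝓝 (E ^ (1 / a)),
      |a * (E ^ (1 / a)) ^ (a - 1) * (E ^ (1 / a) - r) - (E - r ^ a)| ≤
          B * (a * (E ^ (1 / a)) ^ (a - 1) * (E ^ (1 / a) - r)) ^ 2 ∧
        |a * (E ^ (1 / a)) ^ (a - 1) * (E ^ (1 / a) - r) - (E - r ^ a)| ≤
          |a * (E ^ (1 / a)) ^ (a - 1) * (E ^ (1 / a) - r)| / 2 := by
  have radius_pos : 0 < E ^ (1 / a) := Real.rpow_pos_of_pos hE _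
  refine exists_eventually_abs_linearization_sub_le
    (contDiffAt_const.sub (Real.contDiffAt_rpow_const_of_ne radius_pos.ne')).analyticAt ?_ ?_
    (by positivity)
  · rw [one_div, Real.rpow_inv_rpow hE.le ha.ne', sub_self]
  · exact ((Real.hasDerivAt_rpow_const (p := a) (Or.inl radius_pos.ne')).const_sub E).deriv

theorem IsFourierPair.exists_bump_tendsto_integral_near_shell (hD : 1 ≤ D)
    (h : IsFourierPair V Vt) (ha : 0 < a) (hE : 0 < E) :
    ∃ (χ : ContDiffBump (E ^ (1 / a))) (L : ℂ), Tendsto (fun η : ℝ => ∫ k : Space D,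
        ((χ ‖k‖ * ‖V k‖ ^ 2 : ℝ) : ℂ) / ((E - ‖k‖ ^ a : ℝ) + η * Complex.I)) (𝓝[>] 0) (𝓝 L) ∧
      L.im = -Real.pi * shellCoupling a E V := by
  obtain ⟨B, hB, linearization⟩ := exists_eventually_abs_linearization_rpow_sub_le ha hE
  have radius_pos : 0 < E ^ (1 / a) := Real.rpow_pos_of_pos hE _
  obtain ⟨δ, hδ, on_ball⟩ :=
    Metric.eventually_nhds_iff_ball.1 (linearization.and (lt_mem_nhds radius_pos))
  let χ : ContDiffBump (E ^ (1 / a)) := ⟨δ / 2, δ, half_pos hδ, half_lt_self hδ⟩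
  have on_support (r : ℝ) (hr : χ r ≠ 0) := on_ball r (χ.support_eq ▸ hr)
  obtain ⟨L, L_tendsto, L_im⟩ := h.exists_tendsto_integral_near_shell hD χ.hasCompactSupport
    χ.contDiff (fun r hr => (on_support r hr).2) (by fun_prop) (by positivity) hB
    (fun r hr => (on_support r hr).1.1) (fun r hr => (on_support r hr).1.2)
  refine ⟨χ, L, L_tendsto, ?_⟩
  rw [L_im, shellCoupling, density_div_sphereArea hD ha hE, χ.one_of_mem_closedBall
    (Metric.mem_closedBall_self χ.rIn_pos.le)]
  ring

theorem IsFourierPair.exists_tendsto_selfEnergy_above (hD : 1 ≤ D) (h : IsFourierPair V Vt)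
    (ha : 0 < a) (hVa : Integrable fun k : Space D => ‖V k‖ ^ 2 / (1 + ‖k‖ ^ a)) (hE : 0 < E) :
    ∃ L : ℂ, Tendsto (fun η : ℝ => selfEnergy a V (E + η * Complex.I)) (𝓝[>] 0) (𝓝 L) ∧
      L.im = -Real.pi * shellCoupling a E V := by
  obtain ⟨χ, L, near_tendsto, L_im⟩ := h.exists_bump_tendsto_integral_near_shell hD ha hE
  have hV := h.continuous
  have hχ := χ.continuous
  have hp : Measurable fun k : Space D => E - ‖k‖ ^ a := by fun_prop
  have near_integrable : Integrable fun k : Space D => ((χ ‖k‖ * ‖V k‖ ^ 2 : ℝ) : ℂ) :=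
    (h.integrable_cutoff_mul χ.hasCompactSupport hχ).ofReal
  have far_measurable : AEStronglyMeasurable fun k : Space D => (1 - χ ‖k‖) * ‖V k‖ ^ 2 :=
    Continuous.aestronglyMeasurable (by fun_prop)
  have far_vanishes (r : ℝ) (hr : |r - E ^ (1 / a)| < χ.rIn) : 1 - χ r = 0 := by
    rw [χ.one_of_mem_closedBall (Metric.mem_closedBall.2 hr.le), sub_self]
  have far_integrable := integrable_mul_div_sub_rpow ha hE hV.aestronglyMeasurable hVa
    (ψ := fun r => 1 - χ r) (measurable_const.sub hχ.measurable)
    (fun r => abs_le.2 ⟨by linarith [χ.le_one (x := r)], by linarith [χ.nonneg (x := r)]⟩)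
    χ.rIn_pos far_vanishes
  have far_zero (k : Space D) (hk : E - ‖k‖ ^ a = 0) : (1 - χ ‖k‖) * ‖V k‖ ^ 2 = 0 := by
    have on_shell : ‖k‖ = E ^ (1 / a) := by
      rw [sub_eq_zero.1 hk, one_div, Real.rpow_rpow_inv (norm_nonneg k) ha.ne']
    rw [far_vanishes _ (by simpa [on_shell] using χ.rIn_pos), zero_mul]
  refine ⟨_, (near_tendsto.add (tendsto_integral_div_add_mul_I far_measurable hp far_integrable
    far_zero)).congr' ?_, by rw [Complex.add_im, L_im, Complex.ofReal_im, add_zero]⟩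
  filter_upwards [self_mem_nhdsWithin] with η hη
  refine (integral_add (integrable_div_add_mul_I near_integrable hp (ne_of_gt hη))
    (integrable_div_add_mul_I_of_integrable_div far_measurable hp far_integrable far_zero
      η)).symm.trans ?_
  rw [selfEnergy]
  refine integral_congr_ae (ae_of_all _ fun k => ?_)
  push_cast
  ring

theorem selfEnergy_conj (ω : ℂ) :
    selfEnergy a V (starRingEnd ℂ ω) = starRingEnd ℂ (selfEnergy a V ω) := by
  simp only [selfEnergy, ← integral_conj, map_div₀, map_sub, Complex.conj_ofReal]

theorem tendsto_selfEnergy_below {L : ℂ} (hL : Tendsto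
      (fun η : ℝ => selfEnergy a V (E + η * Complex.I)) (𝓝[>] 0) (𝓝 L)) :
    Tendsto (fun η : ℝ => selfEnergy a V (E - η * Complex.I)) (𝓝[>] 0) (𝓝 (starRingEnd ℂ L)) := by
  refine ((Complex.continuous_conj.tendsto L).comp hL).congr fun η => ?_
  simp [← selfEnergy_conj, sub_eq_add_neg]

end Dispersion

section BoundaryValues

variable {X : Type*} [TopologicalSpace X] [T2Space X] [Nonempty X] {f : ℂ → X} {E : ℝ} {L : X}

theorem above_eq_of_tendsto
    (h : Tendsto (fun η : ℝ => f (E + η * Complex.I)) (𝓝[>] 0) (𝓝 L)) : above f E = L :=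
  h.limUnder_eq

theorem hasAbove_of_tendsto
    (h : Tendsto (fun η : ℝ => f (E + η * Complex.I)) (𝓝[>] 0) (𝓝 L)) : HasAbove f E := by
  rwa [HasAbove, above_eq_of_tendsto h]

theorem below_eq_of_tendsto
    (h : Tendsto (fun η : ℝ => f (E - η * Complex.I)) (𝓝[>] 0) (𝓝 L)) : below f E = L :=
  h.limUnder_eq

theorem hasBelow_of_tendsto
    (h : Tendsto (fun η : ℝ => f (E - η * Complex.I)) (𝓝[>] 0) (𝓝 L)) : HasBelow f E := by
  rwa [HasBelow, below_eq_of_tendsto h]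

theorem tendsto_add_mul_I (E : ℝ) :
    Tendsto (fun η : ℝ => (E + η * Complex.I : ℂ)) (𝓝[>] 0) (𝓝 E) := by
  have continuous_path : Continuous fun η : ℝ => (E + η * Complex.I : ℂ) := by fun_prop
  simpa using continuous_path.continuousWithinAt.tendsto (s := Set.Ioi 0) (x := 0)

theorem tendsto_sub_mul_I (E : ℝ) :
    Tendsto (fun η : ℝ => (E - η * Complex.I : ℂ)) (𝓝[>] 0) (𝓝 E) := by
  have continuous_path : Continuous fun η : ℝ => (E - η * Complex.I : ℂ) := by fun_prop
  simpa using continuous_path.continuousWithinAt.tendsto (s := Set.Ioi 0) (x := 0)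

end BoundaryValues

section RankOne

open Matrix

theorem det_add_vecMulVec {n R : Type*} [Fintype n] [DecidableEq n] [CommRing R]
    {A : Matrix n n R} (hA : IsUnit A.det) (x y : n → R) :
    (A + vecMulVec x y).det = A.det * (1 + y ⬝ᵥ A⁻¹ *ᵥ x) := by
  rw [vecMulVec_eq Unit, det_add_replicateCol_mul_replicateRow hA, det_unique (n := Unit),
    Matrix.mul_assoc, ← replicateCol_mulVec, Matrix.add_apply, one_apply_eq,
    replicateRow_mul_replicateCol_apply]

theorem hasDet_one_sub_vecMulVec {ι : Type*} [DecidableEq ι] {x y : ι → ℂ} {s : ℂ}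
    (h : HasSum (fun i => y i * x i) s) : HasDet (1 - vecMulVec x y) (1 - s) := by
  refine (h.const_sub 1).congr fun t => ?_
  have truncation : (1 - vecMulVec x y).submatrix (fun i : t => (i : ι)) (fun i : t => (i : ι)) =
      1 + vecMulVec (fun i : t => x i) (fun i : t => -y i) := by
    ext i j
    simp [Matrix.one_apply, vecMulVec_apply, sub_eq_add_neg]
  rw [truncation, det_add_vecMulVec (by simp), det_one, one_mul, inv_one, one_mulVec, dotProduct,
    Finset.sum_coe_sort t fun i => -y i * x i, sub_eq_add_neg, ← Finset.sum_neg_distrib]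
  simp only [neg_mul]

end RankOne

section Scattering

open Matrix

variable {D N : ℕ} {a E : ℝ} {KR A : Matrix (Fin N) (Fin N) ℂ} {u : EuclideanSpace ℂ (Fin N)}
  {V Vt : Space D → ℂ} {ι : Type*} {l : Filter ι} {ω : ι → ℂ} {z L : ℂ}

/-- The matrix `z 1 - K^R - w |u⟩⟨u|`. Keeping the energy `z` and the self-energy `w` as separate
arguments allows the boundary values `w = K(E ± i0)` at the same real `z = E` to be compared. -/
def emitterMatrix (KR : Matrix (Fin N) (Fin N) ℂ) (u : EuclideanSpace ℂ (Fin N)) (z w : ℂ) :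
    Matrix (Fin N) (Fin N) ℂ :=
  z • 1 - KR - w • vecMulVec u (star u)

theorem K_eq_selfEnergy_smul (ω : ℂ) :
    K a V u ω = selfEnergy a V ω • vecMulVec u (star u) := by
  ext i j
  rw [K, of_apply, Matrix.smul_apply, vecMulVec_apply, smul_eq_mul, selfEnergy,
    ← integral_mul_const]
  refine integral_congr_ae (ae_of_all _ fun k => ?_)
  simp only [couplingVec, star_mul', Pi.star_apply, Complex.ofReal_pow, ← Complex.mul_conj',
    starRingEnd_apply]
  ring

theorem tendsto_K (hK : Tendsto (fun η => selfEnergy a V (ω η)) l (𝓝 L)) :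
    Tendsto (fun η => K a V u (ω η)) l (𝓝 (L • vecMulVec u (star u))) := by
  simpa only [K_eq_selfEnergy_smul] using hK.smul_const _

theorem tendsto_H (hω : Tendsto ω l (𝓝 z))
    (hK : Tendsto (fun η => selfEnergy a V (ω η)) l (𝓝 L)) :
    Tendsto (fun η => H a KR V u (ω η)) l (𝓝 (emitterMatrix KR u z L)) :=
  ((hω.smul_const _).sub_const _).sub (tendsto_K hK)

theorem tendsto_J (hω : Tendsto ω l (𝓝 z))
    (hK : Tendsto (fun η => selfEnergy a V (ω η)) l (𝓝 L)) :
    Tendsto (fun η => J a KR V u (ω η)) l (𝓝 (emitterMatrix KR u z L).det) :=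
  (continuous_id.matrix_det.tendsto _).comp (tendsto_H hω hK)

theorem tendsto_G (hω : Tendsto ω l (𝓝 z))
    (hK : Tendsto (fun η => selfEnergy a V (ω η)) l (𝓝 L))
    (hdet : (emitterMatrix KR u z L).det ≠ 0) :
    Tendsto (fun η => G a KR V u (ω η)) l (𝓝 (emitterMatrix KR u z L)⁻¹) :=
  (continuousAt_matrix_inv _ (by simpa using continuousAt_inv₀ hdet)).tendsto.comp
    (tendsto_H hω hK)

theorem det_emitterMatrix_ne_zero
    (hK : Tendsto (fun η : ℝ => selfEnergy a V (E + η * Complex.I)) (𝓝[>] 0) (𝓝 L))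
    (hE : ¬IsBoundStateInContinuum a KR V u E) : (emitterMatrix KR u E L).det ≠ 0 := by
  contrapose! hE
  obtain ⟨e, e_ne_zero, kernel⟩ := exists_mulVec_eq_zero_iff.2 hE
  exact ⟨e, e_ne_zero, by rwa [above_eq_of_tendsto (tendsto_K hK)]⟩

theorem det_emitterMatrix_div {w w' : ℂ} (hdet : (emitterMatrix KR u z w).det ≠ 0) :
    (emitterMatrix KR u z w').det / (emitterMatrix KR u z w).det =
      1 - (w' - w) * (star u ⬝ᵥ (emitterMatrix KR u z w)⁻¹ *ᵥ u) := by
  have perturbation :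
      emitterMatrix KR u z w' =
        emitterMatrix KR u z w + vecMulVec ((w - w') • u.ofLp) (star u) := by
    rw [emitterMatrix, emitterMatrix, smul_vecMulVec, sub_smul]
    abel
  rw [perturbation, det_add_vecMulVec hdet.isUnit, mul_div_cancel_left₀ _ hdet, mulVec_smul,
    dotProduct_smul, smul_eq_mul]
  ring

theorem S_eq_one_sub_vecMulVec (B : SphericalHarmonics D) (hA : above (G a KR V u) E = A) :
    S B a KR V Vt u E = 1 -
      vecMulVec ((2 * Real.pi * Complex.I * density D a E * (star u ⬝ᵥ A *ᵥ u)) •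
        channelCoupling B a Vt E) (star (channelCoupling B a Vt E)) := by
  have channelVec_eq (γ : Channel D) : channelVec B a Vt u E γ = channelCoupling B a Vt E γ • u :=
    rfl
  ext α β
  rw [S, of_apply, T, hA, channelVec_eq, channelVec_eq, mulVec_smul, dotProduct_smul, star_smul,
    smul_dotProduct, Matrix.sub_apply, one_apply, vecMulVec_apply]
  simp only [smul_eq_mul, Pi.smul_apply, Pi.star_apply]
  ring

theorem IsFourierPair.hasDet_S (hD : 1 ≤ D) (h : IsFourierPair V Vt) (B : SphericalHarmonics D)
    (hE : 0 < E) (hA : above (G a KR V u) E = A) :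
    HasDet (S B a KR V Vt u E)
      (1 - 2 * Real.pi * Complex.I * shellCoupling a E V * (star u ⬝ᵥ A *ᵥ u)) := by
  rw [S_eq_one_sub_vecMulVec B hA]
  refine hasDet_one_sub_vecMulVec ?_
  have sphereArea_ne_zero := Complex.ofReal_ne_zero.2 (sphereArea_pos hD).ne'
  have value : 2 * Real.pi * Complex.I * shellCoupling a E V * (star u ⬝ᵥ A *ᵥ u) =
      2 * Real.pi * Complex.I * (density D a E / sphereArea D) * (star u ⬝ᵥ A *ᵥ u) *
        (shellMass V (E ^ (1 / a)) : ℝ) := by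
    rw [shellCoupling]
    push_cast
    ring
  rw [value]
  refine ((Complex.hasSum_ofReal.2
    (hasSum_sq_norm_channelCoupling hD B h a hE)).mul_left _).congr_fun fun α => ?_
  rw [Complex.ofReal_mul, Complex.ofReal_pow, ← Complex.conj_mul', Pi.star_apply, Pi.smul_apply,
    smul_eq_mul, starRingEnd_apply]
  field_simp

end Scattering
end EmitterScattering

end

theorem theorem6_general (D N : ℕ) (hD : 1 ≤ D) (a : ℝ) (ha : 0 < a)
    (KR : Matrix (Fin N) (Fin N) ℂ)
    (u : EuclideanSpace ℂ (Fin N))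
    (V Vt : EmitterScattering.Space D → ℂ)
    (hV : EmitterScattering.IsFourierPair V Vt)
    (hUV : Integrable (fun k : EmitterScattering.Space D => ‖V k‖ ^ 2 / (1 + ‖k‖ ^ a)))
    (B : EmitterScattering.SphericalHarmonics D)
    (E : ℝ) (hE : 0 < E) :
    EmitterScattering.HasAbove (EmitterScattering.K a V u) E ∧
    EmitterScattering.HasAbove (EmitterScattering.J a KR V u) E ∧
    EmitterScattering.HasBelow (EmitterScattering.J a KR V u) E ∧
    (¬ EmitterScattering.IsBoundStateInContinuum a KR V u E →
      EmitterScattering.HasAbove (EmitterScattering.G a KR V u) E ∧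
      EmitterScattering.above (EmitterScattering.J a KR V u) E ≠ 0 ∧
      EmitterScattering.HasDet (EmitterScattering.S B a KR V Vt u E)
        (EmitterScattering.below (EmitterScattering.J a KR V u) E /
          EmitterScattering.above (EmitterScattering.J a KR V u) E)) := by
  open EmitterScattering in
  obtain ⟨L, selfEnergy_above, L_im⟩ := hV.exists_tendsto_selfEnergy_above hD ha hUV hE
  have J_above := tendsto_J (KR := KR) (u := u) (tendsto_add_mul_I E) selfEnergy_above
  have J_below := tendsto_J (KR := KR) (u := u) (tendsto_sub_mul_I E)
    (tendsto_selfEnergy_below selfEnergy_above)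
  refine ⟨hasAbove_of_tendsto (tendsto_K selfEnergy_above), hasAbove_of_tendsto J_above,
    hasBelow_of_tendsto J_below, fun not_bound => ?_⟩
  have det_ne_zero := det_emitterMatrix_ne_zero selfEnergy_above not_bound
  have G_above := tendsto_G (tendsto_add_mul_I E) selfEnergy_above det_ne_zero
  refine ⟨hasAbove_of_tendsto G_above, by rwa [above_eq_of_tendsto J_above], ?_⟩
  have jump : starRingEnd ℂ L - L = 2 * Real.pi * Complex.I * shellCoupling a E V := by
    rw [← neg_sub, Complex.sub_conj, L_im]
    push_cast
    ring
  rw [above_eq_of_tendsto J_above, below_eq_of_tendsto J_below, det_emitterMatrix_div det_ne_zero,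
    jump]
  exact hV.hasDet_S hD B hE (above_eq_of_tendsto G_above)

theorem theorem6 (D N : ℕ) (hD : 1 ≤ D) (a : ℝ) (ha : 0 < a)
    (KR : Matrix (Fin N) (Fin N) ℂ)
    (u : EuclideanSpace ℂ (Fin N)) (hu : ‖u‖ = 1)
    (V Vt : EmitterScattering.Space D → ℂ)
    (hV : EmitterScattering.IsFourierPair V Vt)
    (hUV : Integrable (fun k : EmitterScattering.Space D => ‖V k‖ ^ 2 / (1 + ‖k‖ ^ a)))
    (B : EmitterScattering.SphericalHarmonics D)
    (E : ℝ) (hE : 0 < E) :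
    EmitterScattering.HasAbove (EmitterScattering.K a V u) E ∧
    EmitterScattering.HasAbove (EmitterScattering.J a KR V u) E ∧
    EmitterScattering.HasBelow (EmitterScattering.J a KR V u) E ∧
    (¬ EmitterScattering.IsBoundStateInContinuum a KR V u E →
      EmitterScattering.HasAbove (EmitterScattering.G a KR V u) E ∧
      EmitterScattering.above (EmitterScattering.J a KR V u) E ≠ 0 ∧
      EmitterScattering.HasDet (EmitterScattering.S B a KR V Vt u E)
        (EmitterScattering.below (EmitterScattering.J a KR V u) E /
          EmitterScattering.above (EmitterScattering.J a KR V u) E)) :=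
  theorem6_general D N hD a ha KR u V Vt hV hUV B E hE
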